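/- **Setting.** $K$ data sources produce $X=(X^k_n)_{k\in[K],\,n\ge 1}$; for $s\subseteq[K]$ let $X^s$ be the data of the sources in $s$, $\mathcal F^s_n$ the $\sigma$-field of their first $n$ observations ($\mathcal F_n:=\mathcal F_n^{[K]}$), and $\mathsf P^s$ the law of $X^s$ under $\mathsf P$. Let $\mathcal P$ be a finite family of laws of $X$, let the units be the pairs, $\mathcal K=\{\{i,j\}:1\le i<j\le K\}$, and for $e\in\mathcal K$ let $\mathcal H^e,\mathcal G^e\subseteq\mathcal P^e=\{\mathsf P^e:\mathsf P\in\mathcal P\}$ be non-empty and disjoint. Put $\mathcal A(\mathsf P)=\{e:\mathsf P^e\in\mathcal G^e\}$ (signals). Let $\Psi$ be a family of subsets of $\mathcal K$ with $\emptyset\in\Psi$, and let $\mathcal P_\Psi$ be the set of $\mathsf P\in\mathcal P$ with $\mathsf P^e\in\mathcal H^e\cup\mathcal G^e$ for all $e$ and $\mathcal A(\mathsf P)\in\Psi$. Put $\mathcal H_0=\mathcal P_{\{\emptyset\}}$, $\mathcal H_{\Psi,e}=\{\mathsf P\in\mathcal P_\Psi\setminus\mathcal H_0: e\notin\mathcal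 A(\mathsf P)\}$ and $\mathcal G_{\Psi,e}=\{\mathsf P\in\mathcal P_\Psi:e\in\mathcal A(\mathsf P)\}$; assume $\mathcal H_0\neq\emptyset$. For $\mathsf P\in\mathcal P_\Psi$ the two components of $X^e$ are independent if $\mathsf P^e\in\mathcal H^e$ and dependent if $\mathsf P^e\in\mathcal G^e$. Let $\Psi_{dis}$ consist of the sets of pairwise disjoint units, and $\Psi_{clus}$ of the sets $A\subseteq\mathcal K$ such that $e,e'\in A$ and $e\triangle e'\in\mathcal K$ imply $e\triangle e'\in A$. For all $e\in\mathcal K$, $e\subseteq s\subseteq[K]$ and $n\ge1$, any $\mathsf P\in\mathcal G_{\Psi,e}\cup\mathcal H_0$ and $\mathsf Q\in\mathcal H_{\Psi,e}\cup\mathcal H_0$ are mutually absolutely continuous on $\mathcal F^s_n$; write $\Lambda_n(\mathsf P^s,\mathsf Q^s)$ for the likelihood ratio and $Z_n=\log\Lambda_n$. If moreover $\mathsf P\in\mathcal G_{\Psi,e}$, there is a positive number $\mathcal I(\mathsf P,\mathsf Q;s)=\mathcal I(\mathsf P^s,\mathsf Q^s)$ with $\mathsf P(\max_{m\le n}Z_m(\mathsf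 P^s,\mathsf Q^s)\ge n\rho)\to0$ for all $\rho>\mathcal I(\mathsf P^s,\mathsf Q^s)$ and $\sum_n\mathsf P(Z_n(\mathsf P^s,\mathsf Q^s)<n\rho)<\infty$ for all $\rho<\mathcal I(\mathsf P^s,\mathsf Q^s)$, and likewise with $\mathsf P$ and $\mathsf Q$ exchanged. Put $\mathcal I(\mathsf P,\mathcal H_{\Psi,e})=\inf_{\mathsf Q\in\mathcal H_{\Psi,e}}\mathcal I(\mathsf P,\mathsf Q;[K])$ ($\inf\emptyset=\infty$) and $\mathcal I(\mathsf P^e,\mathcal H^e)=\inf\{\mathcal I(\mathsf P^e,\mathsf Q^e):\mathsf Q\in\mathcal P_\Psi,\ \mathsf Q^e\in\mathcal H^e\}$. **Tests.** A test is a pair $(T,D)$, where $T\geq 1$ is an $(\mathcal F_n)$-stopping time (possibly infinite) and $D$ is $\Psi$-valued with $\{T=n,D=A\}\in\mathcal F_n$. The class $\mathcal C_\Psi(\alpha,\beta,\gamma,\delta)$ consists of the tests with $\mathsf P(D\ne\emptyset)\le\alpha$ for $\mathsf P\in\mathcal H_0$, and $\mathsf P(D=\emptyset)\le\beta$, $\mathsf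 P(D\setminus\mathcal A(\mathsf P)\ne\emptyset)\le\gamma$, $\mathsf P(\mathcal A(\mathsf P)\setminus D\ne\emptyset,\,D\neq\emptyset)\le\delta$ for $\mathsf P\in\mathcal P_\Psi\setminus\mathcal H_0$. Fix subsystems $s_e,s'_e\supseteq e$ for each unit and reference laws in $\mathcal H_0$ (written $\mathsf P_0$ below; they may depend on $e$ and on the statistic; the statistics do not depend on them up to null sets), and put $$\Lambda_{e,\rm det}(n)=\frac{\max_{\mathsf P\in\mathcal G_{\Psi,e}}\Lambda_n(\mathsf P^{s_e},\mathsf P_0^{s_e})}{\max_{\mathsf P\in\mathcal H_0}\Lambda_n(\mathsf P^{s_e},\mathsf P_0^{s_e})},\qquad \Lambda_{e,\rm iso}(n)=\frac{\max_{\mathsf P\in\mathcal G_{\Psi,e}}\Lambda_n(\mathsf P^{s'_e},\mathsf P_0^{s'_e})}{\max_{\mathsf P\in\mathcal H_{\Psi,e}}\Lambda_n(\mathsf P^{s'_e},\mathsf P_0^{s'_e})},$$ and $D_{\rm iso}(n)=\{e:\Lambda_{e,\rm iso}(n)>1\}$. With positive thresholds $A_e,B_e,C_e,D_e$ let $T_0$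 be the first $n\ge1$ with $\Lambda_{e,\rm det}(n)\le1/C_e$ for all $e$; let $T_{joint}$ be the first $n\ge1$ such that $\Lambda_{e,\rm det}(n)\ge D_e$ for some $e$, $\Lambda_{e,\rm iso}(n)\notin(1/A_e,B_e)$ for all $e$, and $D_{\rm iso}(n)\in\Psi\setminus\{\emptyset\}$. The test $\chi^*=(T^*,D^*)$ has $T^*=\min(T_0,T_{joint})$, $D^*=D_{\rm iso}(T^*)$ if $T_{joint}<T_0$, and $D^*=\emptyset$ otherwise. The thresholds are functions of $(\alpha,\beta,\gamma,\delta)$ such that $\chi^*\in\mathcal C_\Psi(\alpha,\beta,\gamma,\delta)$ for all $\alpha,\beta,\gamma,\delta\in(0,1)$ and, as $\alpha,\beta,\gamma,\delta\to0$, $\log A_e\sim|\log\delta|$, $\log B_e\sim|\log\gamma|$, $\log C_e\sim|\log\beta|$, $\log D_e\sim|\log\alpha|$ for every $e$. Put $${\sf ARE}_{\mathsf P}[\chi^*]=\limsup\frac{\mathsf E_{\mathsf P}[T^*]}{\inf\{\mathsf E_{\mathsf P}[T]:(T,D)\in\mathcal C_\Psi(\alpha,\beta,\gamma,\delta)\}}$$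 as $\alpha,\beta,\gamma,\delta\to0$ such that $|\log\gamma|/(|\log\alpha|\vee|\log\delta|)\to\infty$. **Conditions.** (R) For $\mathsf P,\mathsf Q\in\mathcal P_\Psi$ and $s\subseteq[K]$ with $X^s,X^{s^c}$ independent under $\mathsf P$, the law $\mathsf R=\mathsf Q^s\otimes\mathsf P^{s^c}$ belongs to $\mathcal P$, and $\mathsf R^e\in\mathcal H^e$ for every pair $e$ with one source in $s$ and one in $s^c$. (C) For $A,B\in\Psi$ and $s\subseteq[K]$ such that every $e\in A$ satisfies $e\subseteq s$ or $e\subseteq s^c$, the set $\{e\in B:e\subseteq s\}\cup\{e\in A:e\subseteq s^c\}$ belongs to $\Psi$. (This holds for $\Psi_{dis}$, $\Psi_{clus}$ and the powerset of $\mathcal K$.) (I) For every $\mathsf P\in\mathcal P_\Psi$ and disjoint $s_1,s_2\subseteq[K]$: $X^{s_1},X^{s_2}$ are independent under $\mathsf P$ if and only if $\{i,j\}\notin\mathcal A(\mathsf P)$ for all $i\in s_1$, $j\in s_2$. An *independence partition* for $\mathsf P$ is a partition $[K]=v_0\sqcup v_1\sqcup\dots\sqcup v_L$ with $\mathsf P=\mathsf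 P^{v_0}\otimes\dots\otimes\mathsf P^{v_L}$ in which each of $v_1,\dots,v_L$ contains a pair of $\mathcal A(\mathsf P)$. **Theorem.** Let $\emptyset\in\Psi$ and $\mathsf P\in\mathcal P_\Psi\setminus\mathcal H_0$. (i) Assume (R) and (C), and let $v_0,\dots,v_L$ be an independence partition for $\mathsf P$ with $L>1$. If for every $e\in\mathcal A(\mathsf P)$ there is $l\in\{1,\dots,L\}$ with $s'_e\supseteq v_l\supseteq e$, then ${\sf ARE}_{\mathsf P}[\chi^*]=1$. (ii) If $s'_e=e$ for every $e\in\mathcal K$, then $${\sf ARE}_{\mathsf P}[\chi^*]\le\frac{\min_{e\in\mathcal A(\mathsf P)}\mathcal I(\mathsf P,\mathcal H_{\Psi,e})}{\min_{e\in\mathcal A(\mathsf P)}\mathcal I(\mathsf P^e,\mathcal H^e)}.$$ Moreover, if (R) holds, then this bound equals $1$ and ${\sf ARE}_{\mathsf P}[\chi^*]=1$ under each of the following sets of conditions: - (I) holds, $\Psi=\Psi_{dis}$ and $|\mathcal A(\mathsf P)|>1$; - $\Psi$ is $\Psi_{dis}$, $\Psi_{clus}$ or the powerset of $\mathcal K$,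 there is an independence partition for $\mathsf P$ with $L>1$, and some pair $e\in\mathcal A(\mathsf P)$ is independent of all other sources under $\mathsf P$ and attains $\min_{e\in\mathcal A(\mathsf P)}\mathcal I(\mathsf P^e,\mathcal H^e)$. -/

import Mathlib

open MeasureTheory ProbabilityTheory Filter Topology Asymptotics
open scoped ENNReal

noncomputable section

namespace DepStructure

/-! ### Data -/

/-- The units: unordered pairs of distinct data sources. -/
abbrev Pair (K : ℕ) : Type := {e : Finset (Fin K) // e.card = 2}

/-- The canonical space of the complete data sequence `X`: `x k t` is the value produced by source `k`
at time `t + 1`. -/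
abbrev Paths {K : ℕ} (E : Fin K → Type*) : Type _ := ∀ k, ℕ → E k

/-- The space of the data sequence `X^s` of the sources in `s`. -/
abbrev PathsOn {K : ℕ} (E : Fin K → Type*) (s : Finset (Fin K)) : Type _ := ∀ k : s, ℕ → E k

variable {K : ℕ} {E : Fin K → Type*} [∀ k, MeasurableSpace (E k)]

/-- The random element `X^s`. -/
def proj (s : Finset (Fin K)) : Paths E → PathsOn E s := fun x k => x k

/-- `P^s`, the marginal distribution of `X^s` under `P`. -/
def marginal (P : Measure (Paths E)) (s : Finset (Fin K)) : Measure (PathsOn E s) :=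
  P.map (proj s)

/-- `X^s` and `X^t` are independent under `P`. -/
def IndepSources (P : Measure (Paths E)) (s t : Finset (Fin K)) : Prop :=
  IndepFun (proj (E := E) s) (proj (E := E) t) P

/-- `ℱ_n^s`, the σ-field generated by the first `n` observations of the sources in `s`. -/
def obs (E : Fin K → Type*) [∀ k, MeasurableSpace (E k)] (s : Finset (Fin K)) (n : ℕ) :
    MeasurableSpace (Paths E) :=
  ⨆ k ∈ s, ⨆ t ∈ Finset.range n,
    MeasurableSpace.comap (fun x : Paths E => x k t) inferInstance

theorem obs_le (s : Finset (Fin K)) (n : ℕ) :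
    obs E s n ≤ (inferInstance : MeasurableSpace (Paths E)) := by
  refine iSup₂_le fun k _ => iSup₂_le fun t _ => ?_
  exact Measurable.comap_le (by fun_prop)

/-- `Λ_n(P^s, Q^s)`: the Radon-Nikodym derivative of `P` with respect to `Q` on `ℱ_n^s`. -/
def LR (P Q : Measure (Paths E)) (s : Finset (Fin K)) (n : ℕ) : Paths E → ℝ≥0∞ :=
  @Measure.rnDeriv (Paths E) (obs E s n) (P.trim (obs_le s n)) (Q.trim (obs_le s n))

/-- `Z_n(P^s, Q^s) = log Λ_n(P^s, Q^s)`. -/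
def LLR (P Q : Measure (Paths E)) (s : Finset (Fin K)) (n : ℕ) (x : Paths E) : ℝ :=
  Real.log (LR P Q s n x).toReal

/-- Mutual absolute continuity of `P^s` and `Q^s` on `ℱ_n^s`. -/
def MutuallyAC (P Q : Measure (Paths E)) (s : Finset (Fin K)) (n : ℕ) : Prop :=
  P.trim (obs_le s n) ≪ Q.trim (obs_le s n) ∧ Q.trim (obs_le s n) ≪ P.trim (obs_le s n)

/-- `r` is a (positive) information number of `P` versus `Q` based on the sources in `s`. -/
structure IsInfoNumber (P Q : Measure (Paths E)) (s : Finset (Fin K)) (r : ℝ) : Prop where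
  pos : 0 < r
  max_le : ∀ ρ > r, Tendsto
    (fun n : ℕ => P {x | ∃ m ∈ Finset.Icc 1 n, (n : ℝ) * ρ ≤ LLR P Q s m x}) atTop (𝓝 0)
  summable : ∀ ρ < r,
    ∑' n : ℕ, P {x | LLR P Q s (n + 1) x < ((n + 1 : ℕ) : ℝ) * ρ} < ∞

/-- The defining conditions determine the information number. -/
theorem IsInfoNumber.unique {P Q : Measure (Paths E)} [IsProbabilityMeasure P]
    {s : Finset (Fin K)} {r r' : ℝ} (h : IsInfoNumber P Q s r) (h' : IsInfoNumber P Q s r') :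
    r = r' := by
  have key : ∀ {a b : ℝ}, IsInfoNumber P Q s a → IsInfoNumber P Q s b → ¬ a < b := by
    intro a b ha hb hab
    obtain ⟨ρ, h1, h2⟩ := exists_between hab
    have t1 := (ha.max_le ρ h1).comp (tendsto_add_atTop_nat 1)
    have t2 := ENNReal.tendsto_atTop_zero_of_tsum_ne_top (hb.summable ρ h2).ne
    have t3 := t1.add t2
    rw [add_zero] at t3
    refine absurd (ge_of_tendsto' t3 (b := 1) fun n => ?_) (by simp)
    rw [← measure_univ (μ := P)]
    refine (measure_mono fun x _ => ?_).trans (measure_union_le _ _)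
    rcases lt_or_ge (LLR P Q s (n + 1) x) (((n + 1 : ℕ) : ℝ) * ρ) with h | h
    · exact Or.inr h
    · exact Or.inl ⟨n + 1, by simp, h⟩
  exact le_antisymm (not_lt.1 (key h' h)) (not_lt.1 (key h h'))

open Classical in
/-- `𝓘(P^s, Q^s)`, the information number (with the value `0` if there is none). -/
def info (P Q : Measure (Paths E)) (s : Finset (Fin K)) : ℝ :=
  if h : ∃ r, IsInfoNumber P Q s r then h.choose else 0

/-- `𝓘(P, 𝓠; s)`, the infimum of the information numbers over a family `𝓠`. -/
def infoSet (P : Measure (Paths E)) (𝓠 : Set (Measure (Paths E))) (s : Finset (Fin K)) : ℝ≥0∞ :=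
  ⨅ Q ∈ 𝓠, ENNReal.ofReal (info P Q s)

/-! ### The testing problem -/

/-- The family of plausible distributions, the local hypotheses, and the prior information. -/
structure Problem (K : ℕ) (E : Fin K → Type*) [∀ k, MeasurableSpace (E k)] where
  /-- the plausible global distributions -/
  fam : Set (Measure (Paths E))
  /-- the local null hypotheses -/
  null : (e : Pair K) → Set (Measure (PathsOn E e.1))
  /-- the local alternative hypotheses -/
  alt : (e : Pair K) → Set (Measure (PathsOn E e.1))
  /-- the possible signal sets -/
  Ψ : Set (Set (Pair K))

namespace Problem

variable (M : Problem K E)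

/-- `𝓐(P)`, the set of signals under `P`. -/
def signals (P : Measure (Paths E)) : Set (Pair K) := {e | marginal P e.1 ∈ M.alt e}

/-- `𝓟_Φ`, for a family `Φ` of possible signal sets. -/
def compat (Φ : Set (Set (Pair K))) : Set (Measure (Paths E)) :=
  {P ∈ M.fam | (∀ e, marginal P e.1 ∈ M.null e ∪ M.alt e) ∧ M.signals P ∈ Φ}

/-- `𝓗_0`, the global null distributions. -/
def H0 : Set (Measure (Paths E)) := M.compat {∅}

/-- `𝓗_{Ψ,e}` -/
def HΨ (e : Pair K) : Set (Measure (Paths E)) := {P ∈ M.compat M.Ψ \ M.H0 | e ∉ M.signals P}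

/-- `𝓖_{Ψ,e}` -/
def GΨ (e : Pair K) : Set (Measure (Paths E)) := {P ∈ M.compat M.Ψ | e ∈ M.signals P}

/-- `𝓘(P, 𝓗_{Ψ,e})` -/
def globalInfo (P : Measure (Paths E)) (e : Pair K) : ℝ≥0∞ := infoSet P (M.HΨ e) Finset.univ

/-- `𝓘(P^e, 𝓗^e)`: the infimum runs over the distributions in `𝓟_Ψ` whose marginal on `e` satisfies
the local null. -/
def localInfo (P : Measure (Paths E)) (e : Pair K) : ℝ≥0∞ :=
  infoSet P {Q ∈ M.compat M.Ψ | marginal Q e.1 ∈ M.null e} e.1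

/-- The standing assumptions on the problem of detecting and isolating a dependence structure. -/
structure Standing : Prop where
  finite : M.fam.Finite
  prob : ∀ P ∈ M.fam, IsProbabilityMeasure P
  null_sub : ∀ e, M.null e ⊆ (fun P => marginal P e.1) '' M.fam
  alt_sub : ∀ e, M.alt e ⊆ (fun P => marginal P e.1) '' M.fam
  null_nonempty : ∀ e, (M.null e).Nonempty
  alt_nonempty : ∀ e, (M.alt e).Nonempty
  disjoint : ∀ e, Disjoint (M.null e) (M.alt e)
  null_indep : ∀ P ∈ M.compat M.Ψ, ∀ e : Pair K, marginal P e.1 ∈ M.null e →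
    ∀ i ∈ e.1, ∀ j ∈ e.1, i ≠ j → IndepSources P {i} {j}
  alt_dep : ∀ P ∈ M.compat M.Ψ, ∀ e : Pair K, marginal P e.1 ∈ M.alt e →
    ∀ i ∈ e.1, ∀ j ∈ e.1, i ≠ j → ¬ IndepSources P {i} {j}
  ac : ∀ e : Pair K, ∀ P ∈ M.GΨ e ∪ M.H0, ∀ Q ∈ M.HΨ e ∪ M.H0, ∀ s : Finset (Fin K), e.1 ⊆ s →
    ∀ n, MutuallyAC P Q s n
  info : ∀ e : Pair K, ∀ P ∈ M.GΨ e, ∀ Q ∈ M.HΨ e ∪ M.H0, ∀ s : Finset (Fin K), e.1 ⊆ s →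
    (∃ r, IsInfoNumber P Q s r) ∧ ∃ r, IsInfoNumber Q P s r

/-- Richness of the plausible family: if `X^s` and `X^{sᶜ}` are independent under `P`, then the
product distribution `R = Q^s ⊗ P^{sᶜ}` is plausible, and the pairs with one source in `s` and the
other one in `sᶜ`, which are independent under `R`, satisfy their local null under `R`. -/
def Rich : Prop :=
  ∀ P ∈ M.compat M.Ψ, ∀ Q ∈ M.compat M.Ψ, ∀ s : Finset (Fin K), IndepSources P s sᶜ →
    ∃ R ∈ M.fam, marginal R s = marginal Q s ∧ marginal R sᶜ = marginal P sᶜ ∧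
      IndepSources R s sᶜ ∧
      ∀ e : Pair K, ¬ e.1 ⊆ s → ¬ e.1 ⊆ sᶜ → marginal R e.1 ∈ M.null e

/-- Two disjoint sets of sources are independent if and only if there is no signal between them. -/
def IndepSubs : Prop :=
  ∀ P ∈ M.compat M.Ψ, ∀ s₁ s₂ : Finset (Fin K), Disjoint s₁ s₂ →
    (IndepSources P s₁ s₂ ↔
      ∀ i ∈ s₁, ∀ j ∈ s₂, ∀ e : Pair K, e.1 = {i, j} → e ∉ M.signals P)

/-- `v 0, …, v L` is a partition of the sources with `P = P^{v 0} ⊗ ⋯ ⊗ P^{v L}`, in which each of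
the blocks `v 1, …, v L` contains a dependent pair; `v 0` consists of the remaining sources. -/
structure IsIndepPartition (P : Measure (Paths E)) {L : ℕ} (v : Fin (L + 1) → Finset (Fin K)) :
    Prop where
  disjoint : ∀ l l', l ≠ l' → Disjoint (v l) (v l')
  cover : ∀ k, ∃ l, k ∈ v l
  indep : iIndepFun (fun l => proj (E := E) (v l)) P
  signal : ∀ l, l ≠ 0 → ∃ e ∈ M.signals P, e.1 ⊆ v l

end Problem

/-- The signal sets that consist of disjoint pairs. -/
def psiDis (K : ℕ) : Set (Set (Pair K)) :=
  {A | ∀ e ∈ A, ∀ e' ∈ A, e ≠ e' → Disjoint e.1 e'.1}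

/-- The signal sets that are stable under symmetric differences. -/
def psiClus (K : ℕ) : Set (Set (Pair K)) :=
  {A | ∀ e ∈ A, ∀ e' ∈ A, ∀ f : Pair K, f.1 = symmDiff e.1 e'.1 → f ∈ A}

/-- If no pair of `A ∈ Ψ` has one source in `s` and the other one outside `s`, then the pairs of `A`
in `s` can be replaced by the pairs in `s` of any other `B ∈ Ψ`. -/
def Recombinable (Ψ : Set (Set (Pair K))) : Prop :=
  ∀ A ∈ Ψ, ∀ B ∈ Ψ, ∀ s : Finset (Fin K), (∀ e ∈ A, e.1 ⊆ s ∨ e.1 ⊆ sᶜ) →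
    {e | e ∈ B ∧ e.1 ⊆ s ∨ e ∈ A ∧ e.1 ⊆ sᶜ} ∈ Ψ

/-! ### Tests and error control -/

/-- The four tolerance levels. -/
structure Levels where
  α : ℝ
  β : ℝ
  γ : ℝ
  δ : ℝ

/-- All four levels are in `(0, 1)`. -/
def Levels.Valid (l : Levels) : Prop :=
  l.α ∈ Set.Ioo 0 1 ∧ l.β ∈ Set.Ioo 0 1 ∧ l.γ ∈ Set.Ioo 0 1 ∧ l.δ ∈ Set.Ioo 0 1

/-- `α, β, γ, δ → 0`. -/
def smallLevels : Filter Levels :=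
  comap Levels.α (𝓝[>] 0) ⊓ comap Levels.β (𝓝[>] 0) ⊓ comap Levels.γ (𝓝[>] 0) ⊓
    comap Levels.δ (𝓝[>] 0)

/-- `α, β, γ, δ → 0` such that `|log γ| ≫ |log α| ∨ |log δ|`. -/
def gammaRegime : Filter Levels :=
  smallLevels ⊓
    comap (fun l => |Real.log l.γ| / max |Real.log l.α| |Real.log l.δ|) atTop

/-- A pair `(T, D)` of a time and a decision. -/
structure Procedure (K : ℕ) (E : Fin K → Type*) where
  T : Paths E → ℕ∞
  D : Paths E → Set (Pair K)

/-- `E_P[T]` -/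
def Procedure.ess (χ : Procedure K E) (P : Measure (Paths E)) : ℝ≥0∞ :=
  ∫⁻ x, (χ.T x : ℝ≥0∞) ∂P

namespace Problem

variable (M : Problem K E)

/-- `(T, D)` is a test: `T ≥ 1` is a stopping time and `D` is `Ψ`-valued and `ℱ_T`-measurable. -/
structure IsTest (χ : Procedure K E) : Prop where
  one_le : ∀ x, 1 ≤ χ.T x
  mem : ∀ x, χ.D x ∈ M.Ψ
  stopping : ∀ n : ℕ, MeasurableSet[obs E Finset.univ n] {x | χ.T x = n}
  decision : ∀ n : ℕ, ∀ A ∈ M.Ψ,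
    MeasurableSet[obs E Finset.univ n] {x | χ.T x = n ∧ χ.D x = A}

/-- The class `𝓒_Ψ(α, β, γ, δ)` of tests for joint detection and isolation. -/
structure Controls (l : Levels) (χ : Procedure K E) : Prop where
  test : M.IsTest χ
  false_alarm : ∀ P ∈ M.H0, P {x | χ.D x ≠ ∅} ≤ ENNReal.ofReal l.α
  missed_detection : ∀ P ∈ M.compat M.Ψ \ M.H0, P {x | χ.D x = ∅} ≤ ENNReal.ofReal l.β
  false_positive : ∀ P ∈ M.compat M.Ψ \ M.H0,
    P {x | (χ.D x \ M.signals P).Nonempty} ≤ ENNReal.ofReal l.γ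
  false_negative : ∀ P ∈ M.compat M.Ψ \ M.H0,
    P {x | (M.signals P \ χ.D x).Nonempty ∧ χ.D x ≠ ∅} ≤ ENNReal.ofReal l.δ

/-- `inf {E_P[T] : (T, D) ∈ 𝓒_Ψ(α, β, γ, δ)}` -/
def optimalESS (P : Measure (Paths E)) (l : Levels) : ℝ≥0∞ :=
  ⨅ χ : Procedure K E, ⨅ _ : M.Controls l χ, χ.ess P

/-- The detection and isolation subsystems and the reference distributions in the statistics. -/
structure Design where
  /-- the detection subsystems `s_e` -/
  det : Pair K → Finset (Fin K)
  /-- the isolation subsystems `s'_e` -/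
  iso : Pair K → Finset (Fin K)
  refDet : Pair K → Measure (Paths E)
  refIso : Pair K → Measure (Paths E)
  sub_det : ∀ e, e.1 ⊆ det e
  sub_iso : ∀ e, e.1 ⊆ iso e
  refDet_mem : ∀ e, refDet e ∈ M.H0
  refIso_mem : ∀ e, refIso e ∈ M.H0

variable {M}

/-- The detection statistic of unit `e` at time `n`. -/
def Design.detStat (d : M.Design) (e : Pair K) (n : ℕ) (x : Paths E) : ℝ≥0∞ :=
  (⨆ P ∈ M.GΨ e, LR P (d.refDet e) (d.det e) n x) / ⨆ P ∈ M.H0, LR P (d.refDet e) (d.det e) n x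

/-- The isolation statistic of unit `e` at time `n`. -/
def Design.isoStat (d : M.Design) (e : Pair K) (n : ℕ) (x : Paths E) : ℝ≥0∞ :=
  (⨆ P ∈ M.GΨ e, LR P (d.refIso e) (d.iso e) n x) / ⨆ P ∈ M.HΨ e, LR P (d.refIso e) (d.iso e) n x

/-- `D_iso(n)` -/
def Design.isoSet (d : M.Design) (n : ℕ) (x : Paths E) : Set (Pair K) :=
  {e | 1 < d.isoStat e n x}

end Problem

/-- The thresholds of the units. -/
structure Thresholds (K : ℕ) where
  A : Pair K → ℝ
  B : Pair K → ℝ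
  C : Pair K → ℝ
  D : Pair K → ℝ

namespace Problem

variable {M : Problem K E}

/-- The first time `n ≥ 1` at which all detection statistics are small. -/
def Design.T0 (d : M.Design) (h : Thresholds K) (x : Paths E) : ℕ∞ :=
  ⨅ n ∈ {n : ℕ | 1 ≤ n ∧ ∀ e, d.detStat e n x ≤ ENNReal.ofReal (1 / h.C e)}, (n : ℕ∞)

/-- The first time `n ≥ 1` at which some detection statistic is large, every isolation statistic is
large or small, and the estimated signal set is nonempty and compatible with `Ψ`. -/
def Design.Tjoint (d : M.Design) (h : Thresholds K) (x : Paths E) : ℕ∞ :=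
  ⨅ n ∈ {n : ℕ | 1 ≤ n ∧ (∃ e, ENNReal.ofReal (h.D e) ≤ d.detStat e n x) ∧
    (∀ e, d.isoStat e n x ∉ Set.Ioo (ENNReal.ofReal (1 / h.A e)) (ENNReal.ofReal (h.B e))) ∧
    d.isoSet n x ∈ M.Ψ \ {∅}}, (n : ℕ∞)

open Classical in
/-- The test `χ*` for joint detection and isolation. -/
def Design.chiStar (d : M.Design) (h : Thresholds K) : Procedure K E where
  T x := min (d.T0 h x) (d.Tjoint h x)
  D x := if d.Tjoint h x < d.T0 h x then d.isoSet (d.Tjoint h x).toNat x else ∅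

/-- The thresholds, as functions of the levels, are selected so that `χ*` controls the errors, with
`log A_e ∼ |log δ|`, `log B_e ∼ |log γ|`, `log C_e ∼ |log β|`, `log D_e ∼ |log α|`. -/
structure Design.Selected (d : M.Design) (h : Levels → Thresholds K) : Prop where
  pos : ∀ l : Levels, l.Valid → ∀ e, 0 < (h l).A e ∧ 0 < (h l).B e ∧ 0 < (h l).C e ∧ 0 < (h l).D e
  controls : ∀ l : Levels, l.Valid → M.Controls l (d.chiStar (h l))
  A_equiv : ∀ e, (fun l => Real.log ((h l).A e)) ~[smallLevels] fun l => |Real.log l.δ|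
  B_equiv : ∀ e, (fun l => Real.log ((h l).B e)) ~[smallLevels] fun l => |Real.log l.γ|
  C_equiv : ∀ e, (fun l => Real.log ((h l).C e)) ~[smallLevels] fun l => |Real.log l.β|
  D_equiv : ∀ e, (fun l => Real.log ((h l).D e)) ~[smallLevels] fun l => |Real.log l.α|

/-- The asymptotic relative efficiency of `χ*` under `P` as `α, β, γ, δ → 0` such that
`|log γ| ≫ |log α| ∨ |log δ|`. -/
def Design.ARE (d : M.Design) (h : Levels → Thresholds K) (P : Measure (Paths E)) : ℝ≥0∞ :=
  limsup (fun l => (d.chiStar (h l)).ess P / M.optimalESS P l) gammaRegime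

variable (M)

/-- `min_{e ∈ 𝓐(P)} 𝓘(P, 𝓗_{Ψ,e}) / min_{e ∈ 𝓐(P)} 𝓘(P^e, 𝓗^e)` -/
def efficiencyBound (P : Measure (Paths E)) : ℝ≥0∞ :=
  (⨅ e ∈ M.signals P, M.globalInfo P e) / ⨅ e ∈ M.signals P, M.localInfo P e

end Problem

end DepStructure

end

namespace DepStructure

/-! ### Likelihood ratios -/

/-! When `|log γ|` dominates `|log α|` and `|log δ|`, only protection against false positives costs
time to first order, and everything reduces to comparing information numbers.

Lower bound: a test that declares a signal `e` by time `N` under `P` also declares it under any `Q ∈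
M.HΨ e`, up to the factor exp(log-likelihood ratio). Since `Q` allows this with probability at most
`γ`, a change of measure (`Controls.one_le_add`) gives an optimal expected sample size of at least
about `|log γ| / info P Q univ` (`eventually_le_optimalESS`).

Upper bound: `χ*` has stopped once the true `P` beats each of finitely many competitors by the
required margin. The summability in `IsInfoNumber` makes the exceptional events cost a bounded
expected time, so the expected sample size is at most about `|log γ| / a`, where `a` bounds from
below the numbers `info P Q (d.iso e)` over signals `e` and `Q ∈ M.HΨ e`
(`Selected.eventually_ess_le`). The quotient is `Selected.ARE_le`; the bound below by 1 holds
because `χ*` is itself in the class.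

Efficiency needs the best global competitor to be as hard to reject as the best one on the
subsystem. If the block `s` is independent of the rest under `P`, splice `Q` on `s` with `P` on
`sᶜ`: the likelihood ratio of `P` against the result on all data is that of `P` against `Q` on `s`
(`LR_eq_of_product`), so the two information numbers agree. A signal of `P` outside `s` keeps the
spliced law out of `H0`, hence in `HΨ e` (`Rich.exists_mem_HΨ`). Monotonicity of information in the
sources (`IsInfoNumber.mono`) handles subsystems larger than the block and the converse comparison
of local with global numbers. -/

theorem trim_eq_withDensity_of_indep {Ω : Type*} {m₁ m₂ m m0 : MeasurableSpace Ω}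
    {P R : Measure Ω} [IsProbabilityMeasure P] [IsProbabilityMeasure R] (hm : m ≤ m0)
    (hsup : m = m₁ ⊔ m₂) (hP : Indep m₁ m₂ P) (hR : Indep m₁ m₂ R)
    (hRP : ∀ B, MeasurableSet[m₂] B → R B = P B) {f : Ω → ℝ≥0∞} (hf : Measurable[m₁] f)
    (hfP : ∀ A, MeasurableSet[m₁] A → ∫⁻ x in A, f x ∂ R = P A) :
    P.trim hm = (R.trim hm).withDensity f := by
  have h1 : m₁ ≤ m := hsup ▸ le_sup_left
  have h2 : m₂ ≤ m := hsup ▸ le_sup_right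
  have hfm : Measurable[m] f := hf.mono h1 le_rfl
  have val : ∀ A, MeasurableSet[m] A → (R.trim hm).withDensity f A = ∫⁻ x in A, f x ∂ R :=
    fun A hA => by rw [withDensity_apply _ hA, setLIntegral_trim hm hfm hA]
  -- The intersections `A ∩ B` form a π-system generating `m₁ ⊔ m₂`; on them both measures factor by
  -- independence, and `f` only acts on the `m₁` factor.
  refine ext_of_generate_finite
    (Set.image2 (· ∩ ·) {A | MeasurableSet[m₁] A} {B | MeasurableSet[m₂] B}) ?_ ?_ ?_ ?_
  · rw [hsup]
    refine le_antisymm (sup_le (fun A hA => ?_) fun B hB => ?_)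
      (MeasurableSpace.generateFrom_le ?_)
    · exact MeasurableSpace.measurableSet_generateFrom
        ⟨A, hA, Set.univ, MeasurableSet.univ, Set.inter_univ A⟩
    · exact MeasurableSpace.measurableSet_generateFrom
        ⟨Set.univ, MeasurableSet.univ, B, hB, Set.univ_inter B⟩
    · rintro _ ⟨A, hA, B, hB, rfl⟩
      exact MeasurableSet.inter ((le_sup_left : m₁ ≤ m₁ ⊔ m₂) A hA)
        ((le_sup_right : m₂ ≤ m₁ ⊔ m₂) B hB)
  · rintro _ ⟨A, hA, B, hB, rfl⟩ _ ⟨A', hA', B', hB', rfl⟩ _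
    refine ⟨A ∩ A', MeasurableSet.inter hA hA', B ∩ B', MeasurableSet.inter hB hB', ?_⟩
    exact Set.inter_inter_inter_comm A A' B B'
  · rintro _ ⟨A, hA, B, hB, rfl⟩
    have hA' : MeasurableSet[m] A := h1 A hA
    have hB' : MeasurableSet[m] B := h2 B hB
    have hAB : MeasurableSet[m] (A ∩ B) := MeasurableSet.inter hA' hB'
    show P.trim hm (A ∩ B) = (R.trim hm).withDensity f (A ∩ B)
    rw [val _ hAB, trim_measurableSet_eq hm hAB,
      (Indep_iff _ _ _).1 hP A B hA hB, ← lintegral_indicator (hm _ hAB)]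
    have e1 : (A ∩ B).indicator f = fun x => A.indicator f x * B.indicator (fun _ => 1) x := by
      funext x
      by_cases ha : x ∈ A <;> by_cases hb : x ∈ B <;> simp [ha, hb]
    rw [e1, lintegral_mul_eq_lintegral_mul_lintegral_of_independent_measurableSpace (h1.trans hm)
      (h2.trans hm) hR (hf.indicator hA) (measurable_const.indicator hB),
      lintegral_indicator (hm _ hA'), lintegral_indicator_const (hm _ hB'), hfP A hA, hRP B hB,
      one_mul]
  · rw [val _ MeasurableSet.univ, hfP _ MeasurableSet.univ, trim_measurableSet_eq hm .univ]

variable {K : ℕ} {E : Fin K → Type*} [∀ k, MeasurableSpace (E k)]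

/-! ### Observation σ-fields, marginals and change of measure -/

theorem measurable_proj (s : Finset (Fin K)) : Measurable (proj (E := E) s) := by
  unfold proj; fun_prop

theorem obs_mono {s t : Finset (Fin K)} (h : s ⊆ t) (n : ℕ) : obs E s n ≤ obs E t n :=
  biSup_mono fun _ hk => h hk

theorem obs_union (s t : Finset (Fin K)) (n : ℕ) : obs E (s ∪ t) n = obs E s n ⊔ obs E t n := by
  unfold obs
  simp only [Finset.mem_union]
  exact iSup_union (s := (s : Set (Fin K))) (t := (t : Set (Fin K)))

theorem obs_le_comap_proj (s : Finset (Fin K)) (n : ℕ) :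
    obs E s n ≤ MeasurableSpace.comap (proj (E := E) s) inferInstance := by
  refine iSup₂_le fun k hk => iSup₂_le fun t _ => ?_
  have : (fun x : Paths E => x k t) = (fun y : PathsOn E s => y ⟨k, hk⟩ t) ∘ proj s := rfl
  rw [this, ← MeasurableSpace.comap_comp]
  exact MeasurableSpace.comap_mono (Measurable.comap_le (by fun_prop))

theorem marginal_eq_measure_eq {P Q : Measure (Paths E)} {s : Finset (Fin K)}
    (h : marginal P s = marginal Q s) {A : Set (Paths E)} {n : ℕ} (hA : MeasurableSet[obs E s n] A) :
    P A = Q A := by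
  obtain ⟨B, hB, rfl⟩ := obs_le_comap_proj s n A hA
  have := congrArg (fun μ => μ B) h
  simpa only [marginal, Measure.map_apply (measurable_proj s) hB] using this

theorem IndepSources.indep_obs {P : Measure (Paths E)} {s t : Finset (Fin K)}
    (h : IndepSources P s t) (n : ℕ) : Indep (obs E s n) (obs E t n) P :=
  indep_of_indep_of_le_left (indep_of_indep_of_le_right ((IndepFun_iff_Indep _ _ _).1 h)
    (obs_le_comap_proj t n)) (obs_le_comap_proj s n)

theorem measurable_LR (P Q : Measure (Paths E)) (s : Finset (Fin K)) (n : ℕ) :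
    Measurable[obs E s n] (LR P Q s n) :=
  @Measure.measurable_rnDeriv _ (obs E s n) _ _

theorem measurable_LLR (P Q : Measure (Paths E)) (s : Finset (Fin K)) (n : ℕ) :
    Measurable[obs E s n] (LLR P Q s n) :=
  Real.measurable_log.comp (ENNReal.measurable_toReal.comp (measurable_LR P Q s n))

theorem MutuallyAC.symm {P Q : Measure (Paths E)} {s : Finset (Fin K)} {n : ℕ}
    (h : MutuallyAC P Q s n) : MutuallyAC Q P s n := ⟨h.2, h.1⟩

theorem MutuallyAC.trans {P Q R : Measure (Paths E)} {s : Finset (Fin K)} {n : ℕ}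
    (h : MutuallyAC P Q s n) (h' : MutuallyAC Q R s n) : MutuallyAC P R s n :=
  ⟨h.1.trans h'.1, h'.2.trans h.2⟩

section

variable {P Q R : Measure (Paths E)} {s : Finset (Fin K)} {n : ℕ}

theorem setLIntegral_LR [IsProbabilityMeasure P] [IsProbabilityMeasure Q]
    (h : MutuallyAC P Q s n) {A : Set (Paths E)}
    (hA : MeasurableSet[obs E s n] A) : ∫⁻ x in A, LR P Q s n x ∂Q = P A := by
  rw [← setLIntegral_trim (obs_le s n) (measurable_LR P Q s n) hA]
  unfold LR
  rw [Measure.setLIntegral_rnDeriv h.1, trim_measurableSet_eq _ hA]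

theorem LR_lt_top_ae [IsProbabilityMeasure P]
    (h : MutuallyAC R Q s n) : ∀ᵐ x ∂ R, LR P Q s n x < ∞ :=
  ae_of_ae_trim (obs_le s n) (h.1.ae_le (Measure.rnDeriv_lt_top _ _))

theorem LR_pos_ae [IsProbabilityMeasure P] [IsProbabilityMeasure Q]
    (h : MutuallyAC P Q s n) (h' : MutuallyAC R P s n) :
    ∀ᵐ x ∂ R, 0 < LR P Q s n x :=
  ae_of_ae_trim (obs_le s n) (h'.1.ae_le (Measure.rnDeriv_pos h.1))

/-- The chain rule, almost surely under `P`. -/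
theorem LR_chain [IsProbabilityMeasure P] [IsProbabilityMeasure Q]
    [IsProbabilityMeasure R]
    (h : MutuallyAC P Q s n) (h' : MutuallyAC P R s n) :
    ∀ᵐ x ∂P, LR P R s n x = LR P Q s n x * LR Q R s n x := by
  filter_upwards [ae_of_ae_trim (obs_le s n)
    (h'.1.ae_le (Measure.rnDeriv_mul_rnDeriv (κ := R.trim (obs_le s n)) h.1))] with x hx
  exact hx.symm

theorem ofReal_exp_le_LR {c : ℝ} {x : Paths E} (h0 : 0 < LR P Q s n x) (h1 : LR P Q s n x < ∞)
    (hc : c ≤ LLR P Q s n x) : ENNReal.ofReal (Real.exp c) ≤ LR P Q s n x := by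
  rw [ENNReal.ofReal_le_iff_le_toReal h1.ne]
  exact (Real.le_log_iff_exp_le (ENNReal.toReal_pos h0.ne' h1.ne)).1 hc

theorem LR_le_ofReal_exp {c : ℝ} {x : Paths E} (h0 : 0 < LR P Q s n x) (h1 : LR P Q s n x < ∞)
    (hc : LLR P Q s n x ≤ c) : LR P Q s n x ≤ ENNReal.ofReal (Real.exp c) := by
  rw [ENNReal.le_ofReal_iff_toReal_le h1.ne (Real.exp_pos c).le]
  exact (Real.log_le_iff_le_exp (ENNReal.toReal_pos h0.ne' h1.ne)).1 hc

theorem MutuallyAC.refl (P : Measure (Paths E)) (s : Finset (Fin K)) (n : ℕ) :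
    MutuallyAC P P s n := ⟨Measure.AbsolutelyContinuous.rfl, Measure.AbsolutelyContinuous.rfl⟩

/-- Change of measure by integrating a pointwise bound. The ratio is almost surely positive and
finite, so the default values of `toReal` and `Real.log` in `LLR` do no harm. -/
theorem measure_le_exp_mul [IsProbabilityMeasure P] [IsProbabilityMeasure Q]
    (h : MutuallyAC P Q s n) {A : Set (Paths E)}
    (hA : MeasurableSet[obs E s n] A) {c : ℝ} (hc : ∀ x ∈ A, LLR P Q s n x ≤ c) :
    P A ≤ ENNReal.ofReal (Real.exp c) * Q A := by
  rw [← setLIntegral_LR h hA, ← setLIntegral_const]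
  refine setLIntegral_mono_ae' (obs_le s n A hA) ?_
  filter_upwards [LR_lt_top_ae (P := P) (.refl Q s n), LR_pos_ae h h.symm] with x h1 h0 hx
  exact LR_le_ofReal_exp h0 h1 (hc x hx)

theorem exp_mul_le_measure [IsProbabilityMeasure P] [IsProbabilityMeasure Q]
    (h : MutuallyAC P Q s n) {A : Set (Paths E)}
    (hA : MeasurableSet[obs E s n] A) {c : ℝ} (hc : ∀ x ∈ A, c ≤ LLR P Q s n x) :
    ENNReal.ofReal (Real.exp c) * Q A ≤ P A := by
  rw [← setLIntegral_LR h hA, ← setLIntegral_const]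
  refine setLIntegral_mono_ae' (obs_le s n A hA) ?_
  filter_upwards [LR_lt_top_ae (P := P) (.refl Q s n), LR_pos_ae h h.symm] with x h1 h0 hx
  exact ofReal_exp_le_LR h0 h1 (hc x hx)

/-- The likelihood ratio of `P = P^s ⊗ P^{sᶜ}` against `R = Q^s ⊗ P^{sᶜ}` is that of `P^s` against
`Q^s`. -/
theorem LR_eq_of_product [IsProbabilityMeasure P] [IsProbabilityMeasure Q]
    [IsProbabilityMeasure R]
    (h : MutuallyAC P Q s n) (h' : MutuallyAC P R Finset.univ n)
    (hP : IndepSources P s sᶜ) (hR : IndepSources R s sᶜ) (hRQ : marginal R s = marginal Q s)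
    (hRP : marginal R sᶜ = marginal P sᶜ) :
    ∀ᵐ x ∂P, LR P R Finset.univ n x = LR P Q s n x := by
  have hsup : obs E Finset.univ n = obs E s n ⊔ obs E sᶜ n := by
    rw [← obs_union, Finset.union_compl]
  -- The candidate density is a derivative with respect to `Q` but has to be integrated against `R`;
  -- the two laws agree on the data of `s`.
  have htr : R.trim (obs_le s n) = Q.trim (obs_le s n) := by
    refine @Measure.ext _ (obs E s n) _ _ fun A hA => ?_
    rw [trim_measurableSet_eq _ hA, trim_measurableSet_eq _ hA, marginal_eq_measure_eq hRQ hA]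
  have key := trim_eq_withDensity_of_indep (P := P) (R := R) (obs_le Finset.univ n) hsup
    (hP.indep_obs n) (hR.indep_obs n) (fun B hB => marginal_eq_measure_eq hRP hB)
    (measurable_LR P Q s n) fun A hA => by
      rw [← setLIntegral_LR h hA, ← setLIntegral_trim (obs_le s n) (measurable_LR P Q s n) hA,
        ← setLIntegral_trim (obs_le s n) (measurable_LR P Q s n) hA, htr]
  have := Measure.rnDeriv_withDensity (R.trim (obs_le Finset.univ n))
    ((measurable_LR P Q s n).mono (obs_mono (Finset.subset_univ s) n) le_rfl)
  rw [← key] at this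
  exact ae_of_ae_trim (obs_le _ n) (h'.1.ae_le this)

/-! ### Information numbers -/

theorem IsInfoNumber.info_eq [IsProbabilityMeasure P]
    {r : ℝ} (h : IsInfoNumber P Q s r) : info P Q s = r := by
  have hex : ∃ r, IsInfoNumber P Q s r := ⟨r, h⟩
  rw [info, dif_pos hex]
  exact hex.choose_spec.unique h

theorem isInfoNumber_info [IsProbabilityMeasure P]
    (h : ∃ r, IsInfoNumber P Q s r) : IsInfoNumber P Q s (info P Q s) := by
  obtain ⟨r, hr⟩ := h
  rwa [hr.info_eq]

theorem IsInfoNumber.congr {t : Finset (Fin K)} {r : ℝ} (h : IsInfoNumber P Q s r)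
    (hae : ∀ᵐ x ∂P, ∀ n, LLR P R t n x = LLR P Q s n x) : IsInfoNumber P R t r where
  pos := h.pos
  max_le ρ hρ := by
    refine (h.max_le ρ hρ).congr fun n => measure_congr ?_
    filter_upwards [hae] with x hx
    refine propext ?_
    show (∃ m ∈ Finset.Icc 1 n, _ ≤ LLR P Q s m x) ↔ ∃ m ∈ Finset.Icc 1 n, _ ≤ LLR P R t m x
    simp only [hx]
  summable ρ hρ := by
    convert h.summable ρ hρ using 3 with n
    refine measure_congr ?_
    filter_upwards [hae] with x hx
    refine propext ?_
    show LLR P R t (n + 1) x < _ ↔ LLR P Q s (n + 1) x < _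
    simp only [hx]

/-- Information numbers are monotone in the set of sources. -/
theorem IsInfoNumber.mono [IsProbabilityMeasure P] [IsProbabilityMeasure Q]
    {t : Finset (Fin K)} {a b : ℝ} (hst : s ⊆ t)
    (ha : IsInfoNumber P Q s a) (hb : IsInfoNumber P Q t b) (hs : ∀ n, MutuallyAC P Q s n)
    (ht : ∀ n, MutuallyAC P Q t n) : a ≤ b := by
  by_contra! hab
  -- With `b < ρ < ρ' < a`, the ratio on `s` eventually exceeds `nρ'` and that on `t` stays below
  -- `nρ`, with high `P`-probability.
  obtain ⟨ρ, hbρ, hρa⟩ := exists_between hab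
  obtain ⟨ρ', hρ', hρ'a⟩ := exists_between hρa
  have t1 := (hb.max_le ρ hbρ).comp (tendsto_add_atTop_nat 1)
  have t2 := ENNReal.tendsto_atTop_zero_of_tsum_ne_top (ha.summable ρ' hρ'a).ne
  have t4 : Tendsto (fun n : ℕ => ENNReal.ofReal (Real.exp (((n + 1 : ℕ) : ℝ) * (ρ - ρ'))))
      atTop (𝓝 0) := by
    rw [← ENNReal.ofReal_zero]
    refine ENNReal.tendsto_ofReal (Real.tendsto_exp_atBot.comp ?_)
    exact (tendsto_natCast_atTop_atTop.comp (tendsto_add_atTop_nat 1)).atTop_mul_const_of_neg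
      (sub_neg.2 hρ')
  have t3 := (t1.add t2).add t4
  rw [add_zero, add_zero] at t3
  refine absurd (ge_of_tendsto' t3 (b := 1) fun n => ?_) (by simp)
  set c : ℝ := ((n + 1 : ℕ) : ℝ) with hc
  have hA : MeasurableSet[obs E s (n + 1)] {x | c * ρ' ≤ LLR P Q s (n + 1) x} :=
    measurableSet_le (@measurable_const _ _ _ (obs E s (n + 1)) _) (measurable_LLR P Q s (n + 1))
  have hA' : MeasurableSet[obs E t (n + 1)] {x | c * ρ' ≤ LLR P Q s (n + 1) x} :=
    obs_mono hst _ _ hA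
  have hB : MeasurableSet[obs E t (n + 1)] {x | LLR P Q t (n + 1) x < c * ρ} :=
    measurableSet_lt (measurable_LLR P Q t (n + 1)) (@measurable_const _ _ _ (obs E t (n + 1)) _)
  -- Two opposite changes of measure: passing to `Q` on `t` costs `exp (c * ρ)`, while the `s`-event
  -- has `Q`-probability at most `exp (-c * ρ')`. So three vanishing events would cover the whole
  -- space.
  have hAB : P ({x | c * ρ' ≤ LLR P Q s (n + 1) x} ∩ {x | LLR P Q t (n + 1) x < c * ρ}) ≤
      ENNReal.ofReal (Real.exp (c * (ρ - ρ'))) := by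
    refine (measure_le_exp_mul (ht (n + 1)) (MeasurableSet.inter hA' hB)
      fun x hx => le_of_lt hx.2).trans ?_
    have hQ := exp_mul_le_measure (hs (n + 1)) hA fun x hx => hx
    calc ENNReal.ofReal (Real.exp (c * ρ)) * Q _
        ≤ ENNReal.ofReal (Real.exp (c * (ρ - ρ'))) *
          (ENNReal.ofReal (Real.exp (c * ρ')) * Q {x | c * ρ' ≤ LLR P Q s (n + 1) x}) := by
          rw [← mul_assoc, ← ENNReal.ofReal_mul (Real.exp_pos _).le, ← Real.exp_add]
          rw [show c * (ρ - ρ') + c * ρ' = c * ρ by ring]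
          gcongr
          exact Set.inter_subset_left
      _ ≤ ENNReal.ofReal (Real.exp (c * (ρ - ρ'))) * 1 := by
          gcongr
          exact hQ.trans prob_le_one
      _ = _ := mul_one _
  rw [← measure_univ (μ := P)]
  refine (measure_mono (t := ({x | ∃ m ∈ Finset.Icc 1 (n + 1), c * ρ ≤ LLR P Q t m x} ∪
    {x | LLR P Q s (n + 1) x < c * ρ'}) ∪
    ({x | c * ρ' ≤ LLR P Q s (n + 1) x} ∩ {x | LLR P Q t (n + 1) x < c * ρ})) fun x _ => ?_).trans
    ((measure_union_le _ _).trans (add_le_add (measure_union_le _ _) hAB))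
  rcases lt_or_ge (LLR P Q s (n + 1) x) (c * ρ') with h | h
  · exact Or.inl (Or.inr h)
  rcases lt_or_ge (LLR P Q t (n + 1) x) (c * ρ) with h' | h'
  · exact Or.inr ⟨h, h'⟩
  · exact Or.inl (Or.inl ⟨n + 1, by simp, h'⟩)

/-- The information number of `P = P^s ⊗ P^{sᶜ}` against `R = Q^s ⊗ P^{sᶜ}` is that of `P^s` against
`Q^s`. -/
theorem info_eq_of_product [IsProbabilityMeasure P] [IsProbabilityMeasure Q]
    [IsProbabilityMeasure R]
    (h : ∀ n, MutuallyAC P Q s n) (h' : ∀ n, MutuallyAC P R Finset.univ n)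
    (hP : IndepSources P s sᶜ) (hR : IndepSources R s sᶜ) (hRQ : marginal R s = marginal Q s)
    (hRP : marginal R sᶜ = marginal P sᶜ) (hex : ∃ r, IsInfoNumber P Q s r) :
    info P R Finset.univ = info P Q s := by
  refine ((isInfoNumber_info hex).congr ?_).info_eq
  refine ae_all_iff.2 fun n => ?_
  filter_upwards [LR_eq_of_product (h n) (h' n) hP hR hRQ hRP] with x hx
  rw [LLR, LLR, hx]

end

/-! ### The asymptotic regime -/

theorem tendsto_α_smallLevels : Tendsto Levels.α smallLevels (𝓝[>] 0) :=
  tendsto_comap.mono_left (inf_le_left.trans (inf_le_left.trans inf_le_left))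

theorem tendsto_β_smallLevels : Tendsto Levels.β smallLevels (𝓝[>] 0) :=
  tendsto_comap.mono_left (inf_le_left.trans (inf_le_left.trans inf_le_right))

theorem tendsto_γ_smallLevels : Tendsto Levels.γ smallLevels (𝓝[>] 0) :=
  tendsto_comap.mono_left (inf_le_left.trans inf_le_right)

theorem tendsto_δ_smallLevels : Tendsto Levels.δ smallLevels (𝓝[>] 0) :=
  tendsto_comap.mono_left inf_le_right

theorem eventually_valid : ∀ᶠ l in smallLevels, l.Valid := by
  have h01 : Set.Ioo (0 : ℝ) 1 ∈ 𝓝[>] (0 : ℝ) := Ioo_mem_nhdsGT one_pos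
  filter_upwards [tendsto_α_smallLevels h01, tendsto_β_smallLevels h01,
    tendsto_γ_smallLevels h01, tendsto_δ_smallLevels h01] with l h1 h2 h3 h4
  exact ⟨h1, h2, h3, h4⟩

theorem tendsto_abs_log_nhdsGT_zero : Tendsto (fun t : ℝ => |Real.log t|) (𝓝[>] 0) atTop :=
  tendsto_abs_atBot_atTop.comp Real.tendsto_log_nhdsGT_zero

theorem tendsto_abs_log_γ : Tendsto (fun l : Levels => |Real.log l.γ|) smallLevels atTop :=
  tendsto_abs_log_nhdsGT_zero.comp tendsto_γ_smallLevels

theorem gammaRegime_le : gammaRegime ≤ smallLevels := inf_le_left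

theorem eventually_mul_max_le (C : ℝ) : ∀ᶠ l in gammaRegime,
    C * max |Real.log l.α| |Real.log l.δ| ≤ |Real.log l.γ| := by
  have h : Tendsto (fun l : Levels => |Real.log l.γ| / max |Real.log l.α| |Real.log l.δ|)
      gammaRegime atTop := tendsto_comap.mono_left inf_le_right
  have hα := (tendsto_abs_log_nhdsGT_zero.comp tendsto_α_smallLevels).mono_left gammaRegime_le
  filter_upwards [h.eventually_ge_atTop C, hα.eventually_gt_atTop 0] with l h1 h2
  exact (le_div_iff₀ (lt_max_of_lt_left h2)).1 h1

theorem abs_log_exp_neg {t : ℝ} (ht : 0 ≤ t) : |Real.log (Real.exp (-t))| = t := by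
  rw [Real.log_exp, abs_neg, abs_of_nonneg ht]

/-- Without this the `limsup` defining `ARE` would be trivially 0. Along `α = β = δ = exp (-t)` and
`γ = exp (-t²)` the ratio of logarithms is exactly `t`. -/
theorem neBot_gammaRegime : gammaRegime.NeBot := by
  have h0 : Tendsto (fun t : ℝ => Real.exp (-t)) atTop (𝓝[>] 0) :=
    tendsto_nhdsWithin_iff.2
      ⟨Real.tendsto_exp_neg_atTop_nhds_zero, Eventually.of_forall fun t => Real.exp_pos _⟩
  have hsq : Tendsto (fun t : ℝ => t ^ 2) atTop atTop := tendsto_pow_atTop two_ne_zero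
  let g : ℝ → Levels := fun t =>
    ⟨Real.exp (-t), Real.exp (-t), Real.exp (-t ^ 2), Real.exp (-t)⟩
  have hg : Tendsto g atTop gammaRegime := by
    refine tendsto_inf.2 ⟨tendsto_inf.2 ⟨tendsto_inf.2 ⟨tendsto_inf.2
      ⟨tendsto_comap_iff.2 h0, tendsto_comap_iff.2 h0⟩, tendsto_comap_iff.2 (h0.comp hsq)⟩,
      tendsto_comap_iff.2 h0⟩, tendsto_comap_iff.2 ?_⟩
    refine tendsto_id.congr' ?_
    filter_upwards [eventually_gt_atTop 0] with t ht
    simp only [g, Function.comp, id, abs_log_exp_neg ht.le, abs_log_exp_neg (sq_nonneg t),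
      max_self]
    field_simp
  exact hg.neBot

/-! ### Consequences of the standing assumptions -/

namespace Problem

variable {M : Problem K E} {P Q : Measure (Paths E)} {e : Pair K}

theorem signals_eq_empty_of_mem_H0 (h : P ∈ M.H0) : M.signals P = ∅ := h.2.2

theorem mem_H0_iff (hP : P ∈ M.compat M.Ψ) : P ∈ M.H0 ↔ M.signals P = ∅ :=
  ⟨fun h => h.2.2, fun h => ⟨hP.1, hP.2.1, h⟩⟩

theorem mem_compat_of_mem_H0 (hΨ : ∅ ∈ M.Ψ) (h : P ∈ M.H0) : P ∈ M.compat M.Ψ :=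
  ⟨h.1, h.2.1, (signals_eq_empty_of_mem_H0 h).symm ▸ hΨ⟩

theorem not_mem_H0_of_mem_GΨ (h : P ∈ M.GΨ e) : P ∉ M.H0 := fun h0 => by
  have := h.2
  rw [signals_eq_empty_of_mem_H0 h0] at this
  exact this

namespace Standing

variable (hM : M.Standing)
include hM

theorem prob_of_GΨ (h : P ∈ M.GΨ e) : IsProbabilityMeasure P := hM.prob P h.1.1

theorem prob_of_HΨ_or (h : P ∈ M.HΨ e ∪ M.H0) : IsProbabilityMeasure P :=
  hM.prob P (h.elim (fun h => h.1.1.1) fun h => h.1)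

theorem isInfoNumber (hP : P ∈ M.GΨ e) (hQ : Q ∈ M.HΨ e ∪ M.H0) {s : Finset (Fin K)}
    (hs : e.1 ⊆ s) : IsInfoNumber P Q s (DepStructure.info P Q s) :=
  have := hM.prob_of_GΨ hP
  isInfoNumber_info (hM.info e P hP Q hQ s hs).1

theorem isInfoNumber_symm (hP : P ∈ M.GΨ e) (hQ : Q ∈ M.HΨ e ∪ M.H0) {s : Finset (Fin K)}
    (hs : e.1 ⊆ s) : IsInfoNumber Q P s (DepStructure.info Q P s) :=
  have := hM.prob_of_HΨ_or hQ
  isInfoNumber_info (hM.info e P hP Q hQ s hs).2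

end Standing

/-! ### The lower bound on the expected sample size -/

namespace IsTest

variable {χ : Procedure K E} (hχ : M.IsTest χ)
include hχ

theorem measurableSet_lt (N : ℕ) : MeasurableSet {x | (N : ℕ∞) < χ.T x} := by
  have : {x | (N : ℕ∞) < χ.T x} = (⋃ m ∈ Finset.range (N + 1), {x | χ.T x = (m : ℕ)})ᶜ := by
    ext x
    simp only [Set.mem_ofPred_eq, Set.mem_compl_iff, Set.mem_iUnion, Finset.mem_range,
      exists_prop, not_exists, not_and]
    refine ⟨fun h m hm h' => ?_, fun h => ?_⟩
    · rw [h', Nat.cast_lt] at h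
      omega
    · by_contra! hle
      obtain ⟨m, hm⟩ := ENat.ne_top_iff_exists.1 (ne_top_of_le_ne_top (ENat.natCast_ne_top N) hle)
      rw [← hm, Nat.cast_le] at hle
      exact h m (by omega) hm.symm
  rw [this]
  exact (Finset.measurableSet_biUnion _ fun m _ => obs_le _ _ _ (hχ.stopping m)).compl

theorem measurableSet_mem (n : ℕ) (e : Pair K) :
    MeasurableSet[obs E Finset.univ n] {x | χ.T x = n ∧ e ∈ χ.D x} := by
  have : {x | χ.T x = n ∧ e ∈ χ.D x} =
      ⋃ A ∈ {A ∈ M.Ψ | e ∈ A}, {x | χ.T x = n ∧ χ.D x = A} := by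
    ext x
    simp only [Set.mem_ofPred_eq, Set.mem_iUnion, exists_prop]
    exact ⟨fun h => ⟨_, ⟨hχ.mem x, h.2⟩, h.1, rfl⟩, fun ⟨A, hA, h1, h2⟩ => ⟨h1, h2 ▸ hA.2⟩⟩
  rw [this]
  exact MeasurableSet.biUnion (Set.toFinite _).countable fun A hA => hχ.decision n A hA.1

/-- Markov's inequality for an integer time: `N < T` means `N + 1 ≤ T`, and the extra 1 later
absorbs the rounding of `N`. -/
theorem succ_mul_le_ess (P : Measure (Paths E)) (N : ℕ) :
    ((N + 1 : ℕ) : ℝ≥0∞) * P {x | (N : ℕ∞) < χ.T x} ≤ χ.ess P := by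
  rw [← lintegral_indicator_const (hχ.measurableSet_lt N)]
  refine lintegral_mono (Set.indicator_le' (fun y hy => ?_) fun _ _ => zero_le)
  have : ((N + 1 : ℕ) : ℕ∞) ≤ χ.T y := by
    rw [Nat.cast_add, Nat.cast_one]
    exact Order.add_one_le_of_lt hy
  exact_mod_cast ENat.toENNReal_le.2 this

theorem ess_le_tsum (P : Measure (Paths E)) :
    χ.ess P ≤ ∑' n : ℕ, P {x | (n : ℕ∞) < χ.T x} := by
  simp_rw [← fun n => lintegral_indicator_one (μ := P) (hχ.measurableSet_lt n)]
  rw [← lintegral_tsum fun n => (measurable_one.indicator (hχ.measurableSet_lt n)).aemeasurable]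
  refine lintegral_mono fun x => ?_
  have key : ∀ k : ℕ, (k : ℕ∞) ≤ χ.T x → (k : ℝ≥0∞) ≤
      ∑' n : ℕ, {x | (n : ℕ∞) < χ.T x}.indicator (1 : Paths E → ℝ≥0∞) x := fun k hk => by
    refine le_trans (le_of_eq ?_) (ENNReal.sum_le_tsum (Finset.range k))
    rw [Finset.sum_congr rfl (g := fun _ => 1), Finset.sum_const, Finset.card_range, nsmul_one]
    intro n hn
    refine Set.indicator_of_mem (s := {x | (n : ℕ∞) < χ.T x}) ?_ _
    exact lt_of_lt_of_le (Nat.cast_lt.2 (Finset.mem_range.1 hn)) hk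
  rcases eq_or_ne (χ.T x) ⊤ with hT | hT
  · refine le_of_le_of_eq le_top (ENNReal.eq_top_of_forall_nnreal_le fun r => ?_).symm
    obtain ⟨k, hk⟩ := exists_nat_ge r
    exact (by exact_mod_cast hk : (r : ℝ≥0∞) ≤ k).trans (key k (hT ▸ le_top))
  · obtain ⟨k, hk⟩ := ENat.ne_top_iff_exists.1 hT
    rw [← hk]
    exact_mod_cast key k hk.le

end IsTest

/-- If the test stops by time `N`, it declares nothing (level `β`), declares something but misses a
signal (level `δ`), or declares `e`. In the last case either the log-likelihood ratio has reached `N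
* ρ` by time `N`, or the event transfers to `Q` at cost `exp (N * ρ)`, where declaring `e` is a
false positive (level `γ`). -/
theorem Controls.one_le_add {l : Levels} {χ : Procedure K E} (hχ : M.Controls l χ)
    (hP : P ∈ M.GΨ e) (hQ : Q ∈ M.HΨ e) [IsProbabilityMeasure P] [IsProbabilityMeasure Q]
    (hac : ∀ n, MutuallyAC P Q Finset.univ n) {ρ : ℝ} (N : ℕ) :
    1 ≤ P {x | (N : ℕ∞) < χ.T x} +
      (ENNReal.ofReal l.β + ENNReal.ofReal l.δ +
      (P {x | ∃ m ∈ Finset.Icc 1 N, (N : ℝ) * ρ ≤ LLR P Q Finset.univ m x} +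
        ENNReal.ofReal (Real.exp (N * ρ)) * ENNReal.ofReal l.γ)) := by
  have hP' : P ∈ M.compat M.Ψ \ M.H0 := ⟨hP.1, not_mem_H0_of_mem_GΨ hP⟩
  -- Splitting by the stopping time allows the change of measure at each fixed time; disjointness
  -- reassembles the `Q`-probabilities.
  set S : ℕ → Set (Paths E) := fun m =>
    {x | χ.T x = m ∧ e ∈ χ.D x} ∩ {x | LLR P Q Finset.univ m x < N * ρ}
  have hS : ∀ m, MeasurableSet[obs E Finset.univ m] (S m) := fun m =>
    MeasurableSet.inter (hχ.test.measurableSet_mem m e) (measurableSet_lt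
      (measurable_LLR P Q Finset.univ m) (@measurable_const _ _ _ (obs E Finset.univ m) _))
  have hdisj : Pairwise (Function.onFun Disjoint S) := fun m m' hmm' =>
    Set.disjoint_left.2 fun x hx hx' => hmm' (by
      have := hx.1.1.symm.trans hx'.1.1
      exact_mod_cast this)
  have hSP : P (⋃ m, S m) ≤ ENNReal.ofReal (Real.exp (N * ρ)) * ENNReal.ofReal l.γ := by
    calc P (⋃ m, S m) ≤ ∑' m, P (S m) := measure_iUnion_le _
      _ ≤ ∑' m, ENNReal.ofReal (Real.exp (N * ρ)) * Q (S m) :=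
        ENNReal.tsum_le_tsum fun m => measure_le_exp_mul (hac m) (hS m) fun x hx => le_of_lt hx.2
      _ = ENNReal.ofReal (Real.exp (N * ρ)) * Q (⋃ m, S m) := by
        rw [ENNReal.tsum_mul_left, measure_iUnion hdisj fun m => obs_le _ _ _ (hS m)]
      _ ≤ _ := by
        gcongr
        refine (measure_mono ?_).trans (hχ.false_positive Q hQ.1)
        exact Set.iUnion_subset fun m x hx => ⟨e, hx.1.2, hQ.2⟩
  rw [← measure_univ (μ := P)]
  refine (measure_mono (t := {x | (N : ℕ∞) < χ.T x} ∪ (({x | χ.D x = ∅} ∪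
    {x | (M.signals P \ χ.D x).Nonempty ∧ χ.D x ≠ ∅}) ∪
    ({x | ∃ m ∈ Finset.Icc 1 N, (N : ℝ) * ρ ≤ LLR P Q Finset.univ m x} ∪ ⋃ m, S m)))
    fun x _ => ?_).trans ((measure_union_le _ _).trans (add_le_add le_rfl
    ((measure_union_le _ _).trans (add_le_add ((measure_union_le _ _).trans
      (add_le_add (hχ.missed_detection P hP') (hχ.false_negative P hP')))
      ((measure_union_le _ _).trans (add_le_add le_rfl hSP))))))
  rcases lt_or_ge (N : ℕ∞) (χ.T x) with hT | hT
  · exact Or.inl hT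
  refine Or.inr ?_
  by_cases hD : χ.D x = ∅
  · exact Or.inl (Or.inl hD)
  by_cases he : e ∈ χ.D x
  · refine Or.inr ?_
    obtain ⟨m, hm⟩ := ENat.ne_top_iff_exists.1 (ne_top_of_le_ne_top (ENat.natCast_ne_top N) hT)
    have h1 := hχ.test.one_le x
    rw [← hm] at hT h1
    have hm1 : m ∈ Finset.Icc 1 N := Finset.mem_Icc.2 ⟨by exact_mod_cast h1, by exact_mod_cast hT⟩
    rcases lt_or_ge (LLR P Q Finset.univ m x) (N * ρ) with h | h
    · exact Or.inr (Set.mem_iUnion.2 ⟨m, ⟨hm.symm, he⟩, h⟩)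
    · exact Or.inl ⟨m, hm1, h⟩
  · exact Or.inl (Or.inr ⟨⟨e, hP.2, he⟩, hD⟩)

/-- The asymptotic lower bound on the expected sample size. -/
theorem eventually_le_optimalESS (hM : M.Standing) (hP : P ∈ M.GΨ e) (hQ : Q ∈ M.HΨ e) {c : ℝ}
    (hc : 0 < c) (hcr : c * info P Q Finset.univ < 1) :
    ∀ᶠ l in smallLevels, ENNReal.ofReal (c * |Real.log l.γ|) ≤ M.optimalESS P l := by
  have := hM.prob_of_GΨ hP
  have := hM.prob_of_HΨ_or (Or.inl hQ)
  have hI := hM.isInfoNumber hP (Or.inl hQ) (Finset.subset_univ _)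
  set r := info P Q Finset.univ
  -- Choose `c < c' < 1/r` and then `r < ρ < 1/c'`. With `N ≈ c' |log γ|`, the bound `r < ρ` kills
  -- the large-ratio event and `ρ * c' < 1` kills `exp (N * ρ) * γ`.
  obtain ⟨c', hcc', hc'r⟩ := exists_between ((lt_div_iff₀ hI.pos).2 hcr)
  have hc' : 0 < c' := hc.trans hcc'
  rw [lt_div_iff₀ hI.pos, mul_comm, ← lt_div_iff₀ hc'] at hc'r
  obtain ⟨ρ, hrρ, hρc'⟩ := exists_between hc'r
  have hρ : 0 < ρ := hI.pos.trans hrρ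
  rw [lt_div_iff₀ hc'] at hρc'
  let N : Levels → ℕ := fun l => ⌊c' * |Real.log l.γ|⌋₊
  have hN : Tendsto N smallLevels atTop :=
    tendsto_nat_floor_atTop.comp (tendsto_abs_log_γ.const_mul_atTop hc')
  have t0 : ∀ {f : Levels → ℝ}, Tendsto f smallLevels (𝓝[>] 0) →
      Tendsto (fun l => ENNReal.ofReal (f l)) smallLevels (𝓝 0) := fun hf => by
    rw [← ENNReal.ofReal_zero]
    exact ENNReal.tendsto_ofReal (hf.mono_right nhdsWithin_le_nhds)
  have t1 := (hI.max_le ρ hrρ).comp hN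
  have t2 : Tendsto (fun l : Levels => ENNReal.ofReal (Real.exp (N l * ρ)) * ENNReal.ofReal l.γ)
      smallLevels (𝓝 0) := by
    have h0 : Tendsto (fun l : Levels =>
        ENNReal.ofReal (Real.exp (|Real.log l.γ| * (ρ * c' - 1)))) smallLevels (𝓝 0) := by
      rw [← ENNReal.ofReal_zero]
      exact ENNReal.tendsto_ofReal (Real.tendsto_exp_atBot.comp
        (tendsto_abs_log_γ.atTop_mul_const_of_neg (sub_neg.2 hρc')))
    refine tendsto_of_tendsto_of_tendsto_of_le_of_le' tendsto_const_nhds h0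
      (Eventually.of_forall fun _ => zero_le) ?_
    filter_upwards [eventually_valid] with l hl
    have hγ := hl.2.2.1
    rw [← ENNReal.ofReal_mul (Real.exp_pos _).le]
    refine ENNReal.ofReal_le_ofReal ?_
    have hfl : (N l : ℝ) ≤ c' * |Real.log l.γ| := Nat.floor_le (by positivity)
    have habs : |Real.log l.γ| = -Real.log l.γ := abs_of_neg (Real.log_neg hγ.1 hγ.2)
    calc Real.exp (N l * ρ) * l.γ = Real.exp (N l * ρ + Real.log l.γ) := by
          rw [Real.exp_add, Real.exp_log hγ.1]
      _ ≤ _ := by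
          refine Real.exp_le_exp.2 ?_
          have := mul_le_mul_of_nonneg_right hfl hρ.le
          rw [habs] at this ⊢
          linarith
  have t3 := ((t0 tendsto_β_smallLevels).add (t0 tendsto_δ_smallLevels)).add (t1.add t2)
  simp only [add_zero] at t3
  -- It suffices that `P (N < T) ≥ c / c'`, since `N + 1 ≥ c' |log γ|`.
  have hε : (0 : ℝ≥0∞) < ENNReal.ofReal (1 - c / c') :=
    ENNReal.ofReal_pos.2 (sub_pos.2 ((div_lt_one hc').2 hcc'))
  filter_upwards [t3.eventually_le_const hε] with l hl
  refine le_iInf₂ fun χ hχ => ?_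
  have hprob : ENNReal.ofReal (c / c') ≤ P {x | (N l : ℕ∞) < χ.T x} := by
    have h1 := (hχ.one_le_add hP hQ (fun n => hM.ac e P (Or.inl hP) Q (Or.inl hQ) _
      (Finset.subset_univ _) n) (ρ := ρ) (N l)).trans (add_le_add_right hl _)
    rw [show (1 : ℝ≥0∞) = ENNReal.ofReal (c / c') + ENNReal.ofReal (1 - c / c') by
      rw [← ENNReal.ofReal_add (by positivity) (sub_pos.2 ((div_lt_one hc').2 hcc')).le]
      simp] at h1
    exact (ENNReal.add_le_add_iff_right ENNReal.ofReal_ne_top).1 h1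
  refine le_trans ?_ (hχ.test.succ_mul_le_ess P (N l))
  calc ENNReal.ofReal (c * |Real.log l.γ|)
      = ENNReal.ofReal (c' * |Real.log l.γ|) * ENNReal.ofReal (c / c') := by
        rw [← ENNReal.ofReal_mul (by positivity)]
        congr 1
        field_simp
    _ ≤ _ := by
        gcongr
        rw [← ENNReal.ofReal_natCast]
        refine ENNReal.ofReal_le_ofReal ?_
        exact_mod_cast (Nat.lt_floor_add_one _).le

end Problem

/-! ### The statistics of `χ*` -/

section

variable {P ref : Measure (Paths E)} {S S' : Set (Measure (Paths E))} {s : Finset (Fin K)} {n : ℕ}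
  {x : Paths E} {c : ℝ}

theorem ofReal_exp_mul_LR_le {Q : Measure (Paths E)} (h0 : 0 < LR P Q s n x)
    (h1 : LR P Q s n x < ∞) (h : LR P ref s n x = LR P Q s n x * LR Q ref s n x)
    (hc : c ≤ LLR P Q s n x) : ENNReal.ofReal (Real.exp c) * LR Q ref s n x ≤ LR P ref s n x := by
  rw [h]
  gcongr
  exact ofReal_exp_le_LR h0 h1 hc

theorem ofReal_exp_le_iSup_div (hP : P ∈ S) (h0 : 0 < LR P ref s n x) (h1 : LR P ref s n x < ∞)
    (h : ∀ Q ∈ S', ENNReal.ofReal (Real.exp c) * LR Q ref s n x ≤ LR P ref s n x) :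
    ENNReal.ofReal (Real.exp c) ≤
      (⨆ Q ∈ S, LR Q ref s n x) / ⨆ Q ∈ S', LR Q ref s n x := by
  have hc : ENNReal.ofReal (Real.exp c) ≠ 0 := (ENNReal.ofReal_pos.2 (Real.exp_pos c)).ne'
  have hle : ENNReal.ofReal (Real.exp c) * ⨆ Q ∈ S', LR Q ref s n x ≤ LR P ref s n x := by
    simp only [ENNReal.mul_iSup]
    exact iSup₂_le h
  have hnum : LR P ref s n x ≤ ⨆ Q ∈ S, LR Q ref s n x :=
    le_iSup₂ (f := fun Q (_ : Q ∈ S) => LR Q ref s n x) P hP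
  -- A zero denominator, as for an empty `S'`, is harmless because the numerator is positive; an
  -- infinite one would force `LR P ref s n x = ∞`.
  rw [ENNReal.le_div_iff_mul_le (Or.inr (h0.trans_le hnum).ne') (Or.inl fun htop => ?_)]
  · exact hle.trans hnum
  · rw [htop, ENNReal.mul_top hc] at hle
    exact absurd h1 (not_lt.2 hle)

theorem iSup_div_le_ofReal_exp (hP : P ∈ S')
    (h : ∀ Q ∈ S, ENNReal.ofReal (Real.exp c) * LR Q ref s n x ≤ LR P ref s n x) :
    (⨆ Q ∈ S, LR Q ref s n x) / (⨆ Q ∈ S', LR Q ref s n x) ≤ ENNReal.ofReal (Real.exp (-c)) := by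
  refine ENNReal.div_le_of_le_mul (iSup₂_le fun Q hQ => ?_)
  have h2 : LR P ref s n x ≤ ⨆ Q ∈ S', LR Q ref s n x :=
    le_iSup₂ (f := fun Q (_ : Q ∈ S') => LR Q ref s n x) P hP
  calc LR Q ref s n x
      = ENNReal.ofReal (Real.exp (-c)) * (ENNReal.ofReal (Real.exp c) * LR Q ref s n x) := by
        rw [← mul_assoc, ← ENNReal.ofReal_mul (Real.exp_pos _).le, ← Real.exp_add]
        simp
    _ ≤ _ := by
        gcongr
        exact (h Q hQ).trans h2

/-- Almost surely, a lower bound on the log-likelihood ratio of `P` against `Q` bounds the ratio of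
the likelihoods relative to the reference distribution. -/
theorem ofReal_exp_mul_LR_le_ae {Q : Measure (Paths E)} [IsProbabilityMeasure P]
    [IsProbabilityMeasure Q] [IsProbabilityMeasure ref] (h : ∀ n, MutuallyAC P Q s n)
    (h' : ∀ n, MutuallyAC P ref s n) :
    ∀ᵐ x ∂P, ∀ n, ∀ c ≤ LLR P Q s n x,
      ENNReal.ofReal (Real.exp c) * LR Q ref s n x ≤ LR P ref s n x := by
  refine ae_all_iff.2 fun n => ?_
  filter_upwards [LR_chain (h n) (h' n), LR_pos_ae (h n) (.refl P s n),
    LR_lt_top_ae (P := P) (h n)] with x h1 h2 h3 c hc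
  exact ofReal_exp_mul_LR_le h2 h3 h1 hc

end

/-! ### Upper bound on the expected sample size of `χ*` -/

theorem eventually_le_mul_of_isEquivalent {α : Type*} {F : Filter α} {f g : α → ℝ}
    (h : f ~[F] g) (hg : ∀ᶠ l in F, 0 ≤ g l) {k : ℝ} (hk : 1 < k) :
    ∀ᶠ l in F, f l ≤ k * g l := by
  obtain ⟨φ, hφ, hfg⟩ := h.exists_eq_mul
  filter_upwards [hφ.eventually_le_const hk, hfg, hg] with l h1 h2 h3
  rw [h2]
  exact mul_le_mul_of_nonneg_right h1 h3

theorem tsum_measure_biUnion_lt_top {Ω ι : Type*} [MeasurableSpace Ω] {P : Measure Ω} {S : Set ι}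
    (hS : S.Finite) {B : ι → ℕ → Set Ω} (hB : ∀ i ∈ S, ∑' n, P (B i n) < ∞) :
    ∑' n, P (⋃ i ∈ S, B i n) < ∞ := by
  lift S to Finset ι using hS
  calc ∑' n, P (⋃ i ∈ S, B i n) ≤ ∑' n, ∑ i ∈ S, P (B i n) :=
        ENNReal.tsum_le_tsum fun n => measure_biUnion_finset_le S _
    _ = ∑ i ∈ S, ∑' n, P (B i n) := Summable.tsum_finsetSum fun i _ => ENNReal.summable
    _ < ∞ := ENNReal.sum_lt_top.2 fun i hi => hB i hi

namespace Problem

variable {M : Problem K E} {P : Measure (Paths E)}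

theorem Standing.finite_pairs (hM : M.Standing) {S : Set (Pair K × Measure (Paths E))}
    (hS : ∀ w ∈ S, w.2 ∈ M.fam) : S.Finite :=
  (Set.finite_univ.prod hM.finite).subset fun w hw => ⟨Set.mem_univ _, hS w hw⟩

theorem Design.Tjoint_le {d : M.Design} {h : Thresholds K} (hP : P ∈ M.compat M.Ψ \ M.H0)
    {n : ℕ} {x : Paths E} (hn : 1 ≤ n) (hA : ∀ e, 1 ≤ h.A e) (hB : ∀ e, 1 < h.B e)
    (h1 : ∀ e ∈ M.signals P, ENNReal.ofReal (h.B e) ≤ d.isoStat e n x)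
    (h2 : ∀ e ∉ M.signals P, d.isoStat e n x ≤ ENNReal.ofReal (1 / h.A e))
    (h3 : ∀ e ∈ M.signals P, ENNReal.ofReal (h.D e) ≤ d.detStat e n x) :
    d.Tjoint h x ≤ n := by
  -- Since `1 / A ≤ 1 < B`, crossing the thresholds on the correct sides places every statistic
  -- correctly relative to the cut-off 1. The estimate is then the true signal set, which is
  -- admissible and nonempty.
  have hset : d.isoSet n x = M.signals P := by
    ext e
    refine ⟨fun he => ?_, fun he => ?_⟩
    · by_contra hne
      refine absurd (lt_of_lt_of_le he (h2 e hne)) (not_lt.2 ?_)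
      exact ENNReal.ofReal_le_one.2 ((div_le_one (one_pos.trans_le (hA e))).2 (hA e))
    · exact lt_of_lt_of_le (ENNReal.one_lt_ofReal.2 (hB e)) (h1 e he)
  have hne : M.signals P ≠ ∅ := fun h0 => hP.2 ((mem_H0_iff hP.1).2 h0)
  refine iInf₂_le n ⟨hn, ?_, fun e he => ?_, ?_⟩
  · obtain ⟨e, he⟩ := Set.nonempty_iff_ne_empty.2 hne
    exact ⟨e, h3 e he⟩
  · by_cases hs : e ∈ M.signals P
    · exact absurd he.2 (not_lt.2 (h1 e hs))
    · exact absurd he.1 (not_lt.2 (h2 e hs))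
  · rw [hset]
    exact ⟨hP.1.2.2, hne⟩

/-- Almost surely, `χ*` stops as soon as the log-likelihood ratios of the true distribution against
its competitors are large. -/
theorem Design.Tjoint_le_ae (d : M.Design) (hM : M.Standing) (hP : P ∈ M.compat M.Ψ \ M.H0) :
    ∀ᵐ x ∂P, ∀ (h : Thresholds K) (n : ℕ) (b c : ℝ), 1 ≤ n →
      (∀ e, 1 ≤ h.A e ∧ 1 < h.B e ∧ 0 < h.D e) →
      (∀ e, Real.log (h.B e) ≤ b ∧ Real.log (h.A e) ≤ c ∧ Real.log (h.D e) ≤ c) →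
      (∀ e ∈ M.signals P, ∀ Q ∈ M.HΨ e, b ≤ LLR P Q (d.iso e) n x) →
      (∀ e ∉ M.signals P, ∀ Q ∈ M.GΨ e, c ≤ LLR P Q (d.iso e) n x) →
      (∀ e ∈ M.signals P, ∀ Q ∈ M.H0, c ≤ LLR P Q (d.det e) n x) →
      d.Tjoint h x ≤ n := by
  have := hM.prob P hP.1.1
  have hG : ∀ e ∈ M.signals P, P ∈ M.GΨ e := fun e he => ⟨hP.1, he⟩
  have hH : ∀ e ∉ M.signals P, P ∈ M.HΨ e := fun e he => ⟨hP, he⟩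
  let V₁ : Set (Pair K × Measure (Paths E)) := {w | w.1 ∈ M.signals P ∧ w.2 ∈ M.HΨ w.1}
  let V₂ : Set (Pair K × Measure (Paths E)) := {w | w.1 ∉ M.signals P ∧ w.2 ∈ M.GΨ w.1}
  let V₃ : Set (Pair K × Measure (Paths E)) := {w | w.1 ∈ M.signals P ∧ w.2 ∈ M.H0}
  have hV₁ : V₁.Finite := hM.finite_pairs fun w hw => hw.2.1.1.1
  have hV₂ : V₂.Finite := hM.finite_pairs fun w hw => hw.2.1.1
  have hV₃ : V₃.Finite := hM.finite_pairs fun w hw => hw.2.1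
  have c₁ : ∀ᵐ x ∂P, ∀ w ∈ V₁, ∀ n, ∀ c ≤ LLR P w.2 (d.iso w.1) n x,
      ENNReal.ofReal (Real.exp c) * LR w.2 (d.refIso w.1) (d.iso w.1) n x ≤
        LR P (d.refIso w.1) (d.iso w.1) n x := by
    refine (ae_ball_iff hV₁.countable).2 fun w hw => ?_
    have := hM.prob_of_HΨ_or (Or.inl hw.2)
    have := hM.prob _ (d.refIso_mem w.1).1
    exact ofReal_exp_mul_LR_le_ae
      (hM.ac w.1 P (Or.inl (hG _ hw.1)) w.2 (Or.inl hw.2) _ (d.sub_iso w.1))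
      (hM.ac w.1 P (Or.inl (hG _ hw.1)) _ (Or.inr (d.refIso_mem w.1)) _ (d.sub_iso w.1))
  have c₂ : ∀ᵐ x ∂P, ∀ w ∈ V₂, ∀ n, ∀ c ≤ LLR P w.2 (d.iso w.1) n x,
      ENNReal.ofReal (Real.exp c) * LR w.2 (d.refIso w.1) (d.iso w.1) n x ≤
        LR P (d.refIso w.1) (d.iso w.1) n x := by
    refine (ae_ball_iff hV₂.countable).2 fun w hw => ?_
    have := hM.prob_of_GΨ hw.2
    have := hM.prob _ (d.refIso_mem w.1).1
    -- For a non-signal the roles are exchanged: `P` is the null law. Its absolute continuity with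
    -- respect to the reference goes through the competitor.
    have hac := hM.ac w.1 w.2 (Or.inl hw.2) P (Or.inl (hH _ hw.1)) _ (d.sub_iso w.1)
    exact ofReal_exp_mul_LR_le_ae (fun n => (hac n).symm) fun n => (hac n).symm.trans
      (hM.ac w.1 w.2 (Or.inl hw.2) _ (Or.inr (d.refIso_mem w.1)) _ (d.sub_iso w.1) n)
  have c₃ : ∀ᵐ x ∂P, ∀ w ∈ V₃, ∀ n, ∀ c ≤ LLR P w.2 (d.det w.1) n x,
      ENNReal.ofReal (Real.exp c) * LR w.2 (d.refDet w.1) (d.det w.1) n x ≤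
        LR P (d.refDet w.1) (d.det w.1) n x := by
    refine (ae_ball_iff hV₃.countable).2 fun w hw => ?_
    have := hM.prob _ hw.2.1
    have := hM.prob _ (d.refDet_mem w.1).1
    exact ofReal_exp_mul_LR_le_ae
      (hM.ac w.1 P (Or.inl (hG _ hw.1)) w.2 (Or.inr hw.2) _ (d.sub_det w.1))
      (hM.ac w.1 P (Or.inl (hG _ hw.1)) _ (Or.inr (d.refDet_mem w.1)) _ (d.sub_det w.1))
  have pos : ∀ e : Pair K, ∀ s : Finset (Fin K), e.1 ⊆ s → ∀ ref ∈ M.H0, ∀ᵐ x ∂P,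
      e ∈ M.signals P → ∀ n, 0 < LR P ref s n x ∧ LR P ref s n x < ∞ := by
    intro e s hs ref href
    by_cases he : e ∈ M.signals P
    swap
    · exact Eventually.of_forall fun x h => absurd h he
    have := hM.prob _ href.1
    have hac := hM.ac e P (Or.inl (hG _ he)) _ (Or.inr href) s hs
    filter_upwards [ae_all_iff.2 fun n => LR_pos_ae (hac n) (.refl P s n),
      ae_all_iff.2 fun n => LR_lt_top_ae (P := P) (hac n)] with x h1 h2 _ n
    exact ⟨h1 n, h2 n⟩
  filter_upwards [c₁, c₂, c₃, ae_all_iff.2 fun e => pos e _ (d.sub_iso e) _ (d.refIso_mem e),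
    ae_all_iff.2 fun e => pos e _ (d.sub_det e) _ (d.refDet_mem e)]
    with x h1 h2 h3 h4 h5 h n b c hn hpos hlog hx1 hx2 hx3
  have cmp : ∀ {t c : ℝ}, 0 < t → Real.log t ≤ c → t ≤ Real.exp c := fun ht hle =>
    (Real.log_le_iff_le_exp ht).1 hle
  refine Design.Tjoint_le hP hn (fun e => (hpos e).1) (fun e => (hpos e).2.1)
    (fun e he => ?_) (fun e he => ?_) fun e he => ?_
  · refine (ENNReal.ofReal_le_ofReal (cmp (one_pos.trans (hpos e).2.1) (hlog e).1)).trans ?_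
    exact ofReal_exp_le_iSup_div (S := M.GΨ e) (S' := M.HΨ e) (ref := d.refIso e) (s := d.iso e)
      (hG e he) (h4 e he _).1 (h4 e he _).2 fun Q hQ =>
      h1 (e, Q) ⟨he, hQ⟩ _ _ (hx1 e he Q hQ)
  · refine (iSup_div_le_ofReal_exp (S := M.GΨ e) (S' := M.HΨ e) (ref := d.refIso e)
      (s := d.iso e) (c := c) (hH e he) fun Q hQ =>
      h2 (e, Q) ⟨he, hQ⟩ _ _ (hx2 e he Q hQ)).trans (ENNReal.ofReal_le_ofReal ?_)
    have hA := one_pos.trans_le (hpos e).1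
    rw [Real.exp_neg, one_div]
    exact inv_anti₀ hA (cmp hA (hlog e).2.1)
  · refine (ENNReal.ofReal_le_ofReal (cmp (hpos e).2.2 (hlog e).2.2)).trans ?_
    exact ofReal_exp_le_iSup_div (S := M.GΨ e) (S' := M.H0) (ref := d.refDet e) (s := d.det e)
      (hG e he) (h5 e he _).1 (h5 e he _).2 fun Q hQ =>
      h3 (e, Q) ⟨he, hQ⟩ _ _ (hx3 e he Q hQ)

/-- Tail-sum formula with the index shifted by one: the term at 0 contributes the leading 1, and the
tails before `N` are bounded trivially. -/
theorem IsTest.ess_le [IsProbabilityMeasure P] {χ : Procedure K E} (hχ : M.IsTest χ) {N : ℕ}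
    {bad : ℕ → Set (Paths E)}
    (step : ∀ n, P {x | ((n + 1 : ℕ) : ℕ∞) < χ.T x} ≤ (if n < N then 1 else 0) + P (bad n)) :
    χ.ess P ≤ 1 + ((N : ℝ≥0∞) + ∑' n, P (bad n)) := by
  calc χ.ess P
      ≤ ∑' n : ℕ, P {x | (n : ℕ∞) < χ.T x} := hχ.ess_le_tsum P
    _ = P {x | ((0 : ℕ) : ℕ∞) < χ.T x} +
        ∑' n : ℕ, P {x | ((n + 1 : ℕ) : ℕ∞) < χ.T x} :=
      tsum_eq_zero_add' ENNReal.summable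
    _ ≤ 1 + ∑' n : ℕ, ((if n < N then 1 else 0) + P (bad n)) :=
      add_le_add prob_le_one (ENNReal.tsum_le_tsum step)
    _ = 1 + ((N : ℝ≥0∞) + ∑' n, P (bad n)) := by
      rw [ENNReal.tsum_add, tsum_eq_sum (s := Finset.range N) (by simp),
        Finset.sum_congr rfl (g := fun _ => 1) fun n hn => if_pos (Finset.mem_range.1 hn)]
      simp

/-- This is where the regime enters the upper bound. The margin `κ * ρ > 1` covers `log B ∼ |log
γ|`, whereas `log A` and `log D` are at most twice `|log δ|` and `|log α|`, negligible against `|log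
γ|`; hence `τ > 0` may be arbitrarily small. -/
theorem Design.Selected.eventually_thresholds {d : M.Design} {h : Levels → Thresholds K}
    (hh : d.Selected h) {κ ρ τ : ℝ} (hκ0 : 0 < κ) (hτ : 0 < τ) (hκ : 1 < κ * ρ) :
    ∀ᶠ l in gammaRegime, ∀ e, (1 ≤ (h l).A e ∧ 1 < (h l).B e ∧ 0 < (h l).D e) ∧
      Real.log ((h l).B e) ≤ κ * |Real.log l.γ| * ρ ∧
      Real.log ((h l).A e) ≤ κ * |Real.log l.γ| * τ ∧
      Real.log ((h l).D e) ≤ κ * |Real.log l.γ| * τ := by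
  refine eventually_all.2 fun e => ?_
  have hδ := tendsto_abs_log_nhdsGT_zero.comp tendsto_δ_smallLevels
  have bA := (eventually_le_mul_of_isEquivalent (hh.A_equiv e)
    (Eventually.of_forall fun _ => abs_nonneg _) one_lt_two).filter_mono gammaRegime_le
  have bB := (eventually_le_mul_of_isEquivalent (hh.B_equiv e)
    (Eventually.of_forall fun _ => abs_nonneg _) hκ).filter_mono gammaRegime_le
  have bD := (eventually_le_mul_of_isEquivalent (hh.D_equiv e)
    (Eventually.of_forall fun _ => abs_nonneg _) one_lt_two).filter_mono gammaRegime_le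
  have pA := ((hh.A_equiv e).symm.tendsto_atTop hδ).mono_left gammaRegime_le
  have pB := ((hh.B_equiv e).symm.tendsto_atTop tendsto_abs_log_γ).mono_left gammaRegime_le
  filter_upwards [bA, bB, bD, pA.eventually_ge_atTop 0, pB.eventually_gt_atTop 0,
    eventually_valid.filter_mono gammaRegime_le, eventually_mul_max_le (2 / (κ * τ))]
    with l h1 h2 h3 h4 h5 hl hmax
  obtain ⟨hA, hB, -, hD⟩ := hh.pos l hl e
  rw [div_mul_eq_mul_div, div_le_iff₀ (by positivity)] at hmax
  refine ⟨⟨(Real.log_nonneg_iff hA).1 h4, (Real.log_pos_iff hB.le).1 h5, hD⟩, ?_, ?_, ?_⟩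
  · linarith
  · have := le_max_right |Real.log l.α| |Real.log l.δ|
    linarith
  · have := le_max_left |Real.log l.α| |Real.log l.δ|
    linarith

/-- The asymptotic upper bound on the expected sample size of `χ*`. -/
theorem Design.Selected.eventually_ess_le {d : M.Design} {h : Levels → Thresholds K}
    (hM : M.Standing) (hh : d.Selected h) (hP : P ∈ M.compat M.Ψ \ M.H0) {a c : ℝ}
    (ha : ∀ e ∈ M.signals P, ∀ Q ∈ M.HΨ e, a ≤ info P Q (d.iso e)) (hc0 : 0 < c)
    (hc : 1 < c * a) :
    ∀ᶠ l in gammaRegime, (d.chiStar (h l)).ess P ≤ ENNReal.ofReal (c * |Real.log l.γ|) := by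
  have := hM.prob P hP.1.1
  have hG : ∀ e ∈ M.signals P, P ∈ M.GΨ e := fun e he => ⟨hP.1, he⟩
  have hH : ∀ e ∉ M.signals P, P ∈ M.HΨ e := fun e he => ⟨hP, he⟩
  -- rates
  obtain ⟨ρ, hρ, hρa⟩ := exists_between ((div_lt_iff₀' hc0).2 hc)
  have hρ0 : 0 < ρ := (one_div_pos.2 hc0).trans hρ
  obtain ⟨κ, hκ, hκc⟩ := exists_between ((one_div_lt hc0 hρ0).1 hρ)
  have hκ0 : 0 < κ := (one_div_pos.2 hρ0).trans hκ
  rw [div_lt_iff₀ hρ0] at hκ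
  let V₁ : Set (Pair K × Measure (Paths E)) := {w | w.1 ∈ M.signals P ∧ w.2 ∈ M.HΨ w.1}
  let V₂ : Set (Pair K × Measure (Paths E)) := {w | w.1 ∉ M.signals P ∧ w.2 ∈ M.GΨ w.1}
  let V₃ : Set (Pair K × Measure (Paths E)) := {w | w.1 ∈ M.signals P ∧ w.2 ∈ M.H0}
  have hV₁ : V₁.Finite := hM.finite_pairs fun w hw => hw.2.1.1.1
  have hV₂ : V₂.Finite := hM.finite_pairs fun w hw => hw.2.1.1
  have hV₃ : V₃.Finite := hM.finite_pairs fun w hw => hw.2.1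
  have i₁ : ∀ w ∈ V₁, IsInfoNumber P w.2 (d.iso w.1) (info P w.2 (d.iso w.1)) := fun w hw =>
    hM.isInfoNumber (hG _ hw.1) (Or.inl hw.2) (d.sub_iso w.1)
  have i₂ : ∀ w ∈ V₂, IsInfoNumber P w.2 (d.iso w.1) (info P w.2 (d.iso w.1)) := fun w hw =>
    hM.isInfoNumber_symm hw.2 (Or.inl (hH _ hw.1)) (d.sub_iso w.1)
  have i₃ : ∀ w ∈ V₃, IsInfoNumber P w.2 (d.det w.1) (info P w.2 (d.det w.1)) := fun w hw =>
    hM.isInfoNumber (hG _ hw.1) (Or.inr hw.2) (d.sub_det w.1)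
  -- Finitely many positive information numbers have a common positive strict lower bound.
  obtain ⟨τ, ⟨hτ₂, hτ₃⟩, hτ⟩ : ∃ τ : ℝ, ((∀ w ∈ V₂, τ < info P w.2 (d.iso w.1)) ∧
      ∀ w ∈ V₃, τ < info P w.2 (d.det w.1)) ∧ 0 < τ := by
    have key : ∀ r : ℝ, 0 < r → ∀ᶠ τ in 𝓝[>] (0 : ℝ), τ < r := fun r hr =>
      nhdsWithin_le_nhds (eventually_lt_nhds hr)
    exact ((((eventually_all_finite hV₂).2 fun w hw => key _ (i₂ w hw).pos).and
      ((eventually_all_finite hV₃).2 fun w hw => key _ (i₃ w hw).pos)).and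
        self_mem_nhdsWithin).exists
  let bad : ℕ → Set (Paths E) := fun n =>
    (⋃ w ∈ V₁, {x | LLR P w.2 (d.iso w.1) (n + 1) x < ((n + 1 : ℕ) : ℝ) * ρ}) ∪
    ((⋃ w ∈ V₂, {x | LLR P w.2 (d.iso w.1) (n + 1) x < ((n + 1 : ℕ) : ℝ) * τ}) ∪
    (⋃ w ∈ V₃, {x | LLR P w.2 (d.det w.1) (n + 1) x < ((n + 1 : ℕ) : ℝ) * τ}))
  have hbad : ∑' n, P (bad n) < ∞ := by
    refine (ENNReal.tsum_le_tsum fun n => (measure_union_le _ _).trans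
      (add_le_add le_rfl (measure_union_le _ _))).trans_lt ?_
    rw [ENNReal.tsum_add, ENNReal.tsum_add]
    refine ENNReal.add_lt_top.2 ⟨?_, ENNReal.add_lt_top.2 ⟨?_, ?_⟩⟩
    · exact tsum_measure_biUnion_lt_top hV₁ fun w hw =>
        (i₁ w hw).summable ρ (hρa.trans_le (ha _ hw.1 _ hw.2))
    · exact tsum_measure_biUnion_lt_top hV₂ fun w hw => (i₂ w hw).summable τ (hτ₂ w hw)
    · exact tsum_measure_biUnion_lt_top hV₃ fun w hw => (i₃ w hw).summable τ (hτ₃ w hw)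
  have hL : Tendsto (fun l : Levels => |Real.log l.γ|) gammaRegime atTop :=
    tendsto_abs_log_γ.mono_left gammaRegime_le
  have ev := hh.eventually_thresholds hκ0 hτ hκ
  have evC := (hL.const_mul_atTop (sub_pos.2 hκc)).eventually_ge_atTop
    (2 + (∑' n, P (bad n)).toReal)
  filter_upwards [ev, evC, eventually_valid.filter_mono gammaRegime_le] with l hl hlC hval
  set N : ℕ := ⌈κ * |Real.log l.γ|⌉₊ with hN
  have htest := (hh.controls l hval).test
  have step : ∀ n, P {x | ((n + 1 : ℕ) : ℕ∞) < (d.chiStar (h l)).T x} ≤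
      (if n < N then 1 else 0) + P (bad n) := by
    intro n
    split_ifs with hn
    · exact prob_le_one.trans le_self_add
    rw [zero_add]
    refine measure_mono_ae ?_
    filter_upwards [d.Tjoint_le_ae hM hP] with x hx hlt
    by_contra hxn
    obtain ⟨hx1, hx23⟩ := not_or.1 hxn
    obtain ⟨hx2, hx3⟩ := not_or.1 hx23
    simp only [Set.mem_iUnion, not_exists] at hx1 hx2 hx3
    have hnN : κ * |Real.log l.γ| ≤ ((n + 1 : ℕ) : ℝ) := by
      refine (Nat.le_ceil _).trans ?_
      exact_mod_cast (not_lt.1 hn).trans (Nat.le_succ n)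
    -- `T*` is at most `Tjoint`, so the competing time `T0` can only shorten the sample.
    refine absurd (lt_of_lt_of_le hlt (min_le_right _ _)) (not_lt.2 ?_)
    refine hx (h l) (n + 1) (((n + 1 : ℕ) : ℝ) * ρ) (((n + 1 : ℕ) : ℝ) * τ) (Nat.le_add_left 1 n)
      (fun e => (hl e).1) (fun e => ⟨?_, ?_, ?_⟩)
      (fun e he Q hQ => not_lt.1 (hx1 (e, Q) ⟨he, hQ⟩))
      (fun e he Q hQ => not_lt.1 (hx2 (e, Q) ⟨he, hQ⟩))
      (fun e he Q hQ => not_lt.1 (hx3 (e, Q) ⟨he, hQ⟩))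
    · exact (hl e).2.1.trans (mul_le_mul_of_nonneg_right hnN hρ0.le)
    · exact (hl e).2.2.1.trans (mul_le_mul_of_nonneg_right hnN hτ.le)
    · exact (hl e).2.2.2.trans (mul_le_mul_of_nonneg_right hnN hτ.le)
  calc (d.chiStar (h l)).ess P
      ≤ 1 + ((N : ℝ≥0∞) + ∑' n, P (bad n)) := htest.ess_le step
    _ = ENNReal.ofReal (1 + (N + (∑' n, P (bad n)).toReal)) := by
      rw [ENNReal.ofReal_add zero_le_one (by positivity), ENNReal.ofReal_add (by positivity)
        ENNReal.toReal_nonneg, ENNReal.ofReal_toReal hbad.ne, ENNReal.ofReal_one,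
        ENNReal.ofReal_natCast]
    _ ≤ ENNReal.ofReal (c * |Real.log l.γ|) := by
      refine ENNReal.ofReal_le_ofReal ?_
      have := (Nat.ceil_lt_add_one (by positivity : 0 ≤ κ * |Real.log l.γ|)).le
      rw [← hN] at this
      rw [sub_mul] at hlC
      linarith

end Problem

/-! ### Independent blocks of sources -/

theorem marginal_congr_of_subset {P Q : Measure (Paths E)} {s t : Finset (Fin K)} (hst : s ⊆ t)
    (h : marginal P t = marginal Q t) : marginal P s = marginal Q s := by
  let g : PathsOn E t → PathsOn E s := fun y k => y ⟨k, hst k.2⟩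
  have hg : Measurable g := by fun_prop
  have key : ∀ P : Measure (Paths E), marginal P s = (marginal P t).map g := fun P => by
    rw [marginal, marginal, Measure.map_map hg (measurable_proj t)]
    rfl
  rw [key, key, h]

theorem IndepSources.mono {P : Measure (Paths E)} {s t s' t' : Finset (Fin K)}
    (h : IndepSources P s t) (hs : s' ⊆ s) (ht : t' ⊆ t) : IndepSources P s' t' := by
  let g : PathsOn E s → PathsOn E s' := fun y k => y ⟨k, hs k.2⟩
  let g' : PathsOn E t → PathsOn E t' := fun y k => y ⟨k, ht k.2⟩
  have hg : Measurable g := by fun_prop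
  have hg' : Measurable g' := by fun_prop
  exact IndepFun.comp h hg hg'

namespace Problem

variable {M : Problem K E} {P Q : Measure (Paths E)} {e : Pair K}

theorem IsIndepPartition.indepSources_compl {L : ℕ} {v : Fin (L + 1) → Finset (Fin K)}
    (hv : M.IsIndepPartition P v) (l : Fin (L + 1)) : IndepSources P (v l) (v l)ᶜ := by
  -- Each source outside `v l` is read off from some other block, which makes the complement a
  -- measurable function of the remaining blocks.
  choose idx hidx using hv.cover
  have hne : ∀ k ∈ (v l)ᶜ, idx k ∈ ({l}ᶜ : Finset (Fin (L + 1))) := fun k hk =>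
    Finset.mem_compl.2 fun h => Finset.mem_compl.1 hk (Finset.mem_singleton.1 h ▸ hidx k)
  have h := hv.indep.indepFun_finset {l} {l}ᶜ disjoint_compl_right
    fun i => measurable_proj (v i)
  let g : (∀ i : ({l} : Finset (Fin (L + 1))), PathsOn E (v i)) → PathsOn E (v l) :=
    fun y => y ⟨l, Finset.mem_singleton_self l⟩
  let g' : (∀ i : ({l}ᶜ : Finset (Fin (L + 1))), PathsOn E (v i)) → PathsOn E (v l)ᶜ :=
    fun y k => y ⟨idx k, hne k k.2⟩ ⟨k, hidx k⟩
  have hg : Measurable g := measurable_pi_apply _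
  have hg' : Measurable g' := measurable_pi_lambda _ fun k =>
    (measurable_pi_apply (⟨k, hidx k⟩ : v (idx k))).comp
      (measurable_pi_apply (⟨idx k, hne k k.2⟩ : ({l}ᶜ : Finset (Fin (L + 1)))))
  exact IndepFun.comp h hg hg'

theorem IsIndepPartition.exists_signal_ne {L : ℕ} {v : Fin (L + 1) → Finset (Fin K)}
    (hv : M.IsIndepPartition P v) (hL : 1 < L) (l : Fin (L + 1)) :
    ∃ l', l' ≠ l ∧ ∃ e ∈ M.signals P, e.1 ⊆ v l' := by
  -- As `L > 1`, the indices 1 and 2 both exist and cannot both equal `l`.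
  obtain ⟨l', h0, hl⟩ : ∃ l' : Fin (L + 1), l' ≠ 0 ∧ l' ≠ l := by
    by_contra! h
    have h1 := h ⟨1, by omega⟩ (by simp [Fin.ext_iff])
    have h2 := h ⟨2, by omega⟩ (by simp [Fin.ext_iff])
    simp [← h1, Fin.ext_iff] at h2
  exact ⟨l', hl, hv.signal l' h0⟩

theorem IsIndepPartition.exists_signal_subset_compl {L : ℕ} {v : Fin (L + 1) → Finset (Fin K)}
    (hv : M.IsIndepPartition P v) (hL : 1 < L) (l : Fin (L + 1)) :
    ∃ e ∈ M.signals P, e.1 ⊆ (v l)ᶜ := by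
  obtain ⟨l', hl, e, he, hel⟩ := hv.exists_signal_ne hL l
  exact ⟨e, he, fun k hk => Finset.mem_compl.2 fun hk' =>
    Finset.disjoint_left.1 (hv.disjoint l' l hl) (hel hk) hk'⟩

/-- A signal straddling `s` and `sᶜ` would have independent components, contradicting `alt_dep`. -/
theorem Standing.subset_or_of_mem_signals (hM : M.Standing) (hP : P ∈ M.compat M.Ψ)
    {s : Finset (Fin K)} (hs : IndepSources P s sᶜ) (he : e ∈ M.signals P) :
    e.1 ⊆ s ∨ e.1 ⊆ sᶜ := by
  by_contra! h
  obtain ⟨i, hi, his⟩ := Finset.not_subset.1 h.1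
  obtain ⟨j, hj, hjs⟩ := Finset.not_subset.1 h.2
  rw [Finset.mem_compl, not_not] at hjs
  exact hM.alt_dep P hP e he j hj i hi (fun h => his (h ▸ hjs))
    (hs.mono (Finset.singleton_subset_iff.2 hjs)
      (Finset.singleton_subset_iff.2 (Finset.mem_compl.2 his)))

/-- Replacing the independent block `s` of `P` by the one of a distribution `Q` without a signal in
`e ⊆ s` gives a distribution in `𝓗_{Ψ,e}`, whose information number is that of the block. -/
theorem Rich.exists_mem_HΨ (hR : M.Rich) (hM : M.Standing) (hΨ : ∅ ∈ M.Ψ) (hP : P ∈ M.GΨ e)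
    (hQ : Q ∈ M.HΨ e ∪ M.H0) {s : Finset (Fin K)} (hes : e.1 ⊆ s) (hs : IndepSources P s sᶜ)
    (hsig : ∃ f ∈ M.signals P, f.1 ⊆ sᶜ)
    (hmem : {f | f ∈ M.signals Q ∧ f.1 ⊆ s ∨ f ∈ M.signals P ∧ f.1 ⊆ sᶜ} ∈ M.Ψ) :
    ∃ R ∈ M.HΨ e, info P R Finset.univ = info P Q s := by
  have hQc : Q ∈ M.compat M.Ψ := hQ.elim (fun h => h.1.1) fun h => mem_compat_of_mem_H0 hΨ h
  have heQ : e ∉ M.signals Q := hQ.elim (fun h => h.2) fun h h' => by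
    rw [signals_eq_empty_of_mem_H0 h] at h'
    exact h'
  have hnot : ∀ f : Pair K, f.1 ⊆ s → ¬ f.1 ⊆ sᶜ := fun f h h' => by
    obtain ⟨k, hk⟩ := Finset.card_pos.1 (by rw [f.2]; exact two_pos : 0 < f.1.card)
    exact Finset.mem_compl.1 (h' hk) (h hk)
  obtain ⟨R, hRf, hRQ, hRP, hRi, hnull⟩ := hR P hP.1 Q hQc s hs
  have hm1 : ∀ f : Pair K, f.1 ⊆ s → marginal R f.1 = marginal Q f.1 := fun f hf =>
    marginal_congr_of_subset hf hRQ
  have hm2 : ∀ f : Pair K, f.1 ⊆ sᶜ → marginal R f.1 = marginal P f.1 := fun f hf =>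
    marginal_congr_of_subset hf hRP
  -- Pairs within `s` inherit their status from `Q`, pairs within `sᶜ` from `P`, and straddling
  -- pairs are null by richness.
  have hsR : M.signals R =
      {f | f ∈ M.signals Q ∧ f.1 ⊆ s ∨ f ∈ M.signals P ∧ f.1 ⊆ sᶜ} := by
    ext f
    by_cases h1 : f.1 ⊆ s
    · simp only [signals, Set.mem_ofPred_eq, hm1 f h1, h1, hnot f h1, and_true, and_false, or_false]
    by_cases h2 : f.1 ⊆ sᶜ
    · simp only [signals, Set.mem_ofPred_eq, hm2 f h2, h2, h1, and_true, and_false, false_or]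
    · simp only [signals, Set.mem_ofPred_eq, h2, h1, and_false, or_false, iff_false]
      exact Set.disjoint_left.1 (hM.disjoint f) (hnull f h1 h2)
  have hRc : R ∈ M.compat M.Ψ := by
    refine ⟨hRf, fun f => ?_, hsR ▸ hmem⟩
    by_cases h1 : f.1 ⊆ s
    · exact hm1 f h1 ▸ hQc.2.1 f
    by_cases h2 : f.1 ⊆ sᶜ
    · exact hm2 f h2 ▸ hP.1.2.1 f
    · exact Or.inl (hnull f h1 h2)
  have hRH : R ∈ M.HΨ e := by
    refine ⟨⟨hRc, fun h0 => ?_⟩, ?_⟩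
    -- The surviving signal of `P` outside `s` excludes the global null; without one, splicing with
    -- `Q ∈ M.H0` would leave `M.HΨ e`.
    · obtain ⟨f, hf, hfs⟩ := hsig
      have : f ∈ M.signals R := hsR ▸ Or.inr ⟨hf, hfs⟩
      rw [signals_eq_empty_of_mem_H0 h0] at this
      exact this
    · rw [hsR]
      exact fun h => h.elim (fun h => heQ h.1) fun h => hnot e hes h.2
  have := hM.prob_of_GΨ hP
  have := hM.prob_of_HΨ_or hQ
  have := hM.prob R hRf
  exact ⟨R, hRH, info_eq_of_product (hM.ac e P (Or.inl hP) Q hQ s hes)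
    (hM.ac e P (Or.inl hP) R (Or.inl hRH) _ (Finset.subset_univ _)) hs hRi hRQ hRP
    (hM.info e P hP Q hQ s hes).1⟩

/-! ### Minimal information numbers -/

theorem Standing.info_mono (hM : M.Standing) (hP : P ∈ M.GΨ e) (hQ : Q ∈ M.HΨ e ∪ M.H0)
    {s t : Finset (Fin K)} (hes : e.1 ⊆ s) (hst : s ⊆ t) :
    DepStructure.info P Q s ≤ DepStructure.info P Q t := by
  have := hM.prob_of_GΨ hP
  have := hM.prob_of_HΨ_or hQ
  exact IsInfoNumber.mono hst (hM.isInfoNumber hP hQ hes) (hM.isInfoNumber hP hQ (hes.trans hst))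
    (hM.ac e P (Or.inl hP) Q hQ s hes) (hM.ac e P (Or.inl hP) Q hQ t (hes.trans hst))

theorem Standing.exists_iInf_infoSet_eq (hM : M.Standing) {A : Set (Pair K)}
    {𝓠 : Pair K → Set (Measure (Paths E))} (h𝓠 : ∀ e, 𝓠 e ⊆ M.fam)
    (s : Pair K → Finset (Fin K)) (hne : ∃ e ∈ A, (𝓠 e).Nonempty) :
    ∃ e ∈ A, ∃ Q ∈ 𝓠 e, ⨅ e ∈ A, infoSet P (𝓠 e) (s e) =
      ENNReal.ofReal (DepStructure.info P Q (s e)) ∧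
      ∀ e' ∈ A, ∀ Q' ∈ 𝓠 e', DepStructure.info P Q (s e) ≤ DepStructure.info P Q' (s e') := by
  have hfin : {w : Pair K × Measure (Paths E) | w.1 ∈ A ∧ w.2 ∈ 𝓠 w.1}.Finite :=
    hM.finite_pairs fun w hw => h𝓠 _ hw.2
  obtain ⟨e₀, he₀, Q₀, hQ₀⟩ := hne
  obtain ⟨⟨e, Q⟩, hw, hmin⟩ := Set.exists_min_image _
    (fun w => DepStructure.info P w.2 (s w.1)) hfin ⟨(e₀, Q₀), he₀, hQ₀⟩
  refine ⟨e, hw.1, Q, hw.2, le_antisymm ?_ ?_, fun e' he' Q' hQ' => hmin (e', Q') ⟨he', hQ'⟩⟩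
  · exact (iInf₂_le e hw.1).trans (iInf₂_le Q hw.2)
  · exact le_iInf₂ fun e' he' => le_iInf₂ fun Q' hQ' =>
      ENNReal.ofReal_le_ofReal (hmin (e', Q') ⟨he', hQ'⟩)

/-- The local infimum also ranges over the global null, unlike the global one; this is why the
splicing lemma accepts `Q` from `M.H0` too. -/
theorem Standing.setOf_marginal_mem_null (hM : M.Standing) (hΨ : ∅ ∈ M.Ψ) (e : Pair K) :
    {Q ∈ M.compat M.Ψ | marginal Q e.1 ∈ M.null e} = M.HΨ e ∪ M.H0 := by
  ext Q
  constructor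
  · rintro ⟨hQ, hn⟩
    by_cases h0 : Q ∈ M.H0
    · exact Or.inr h0
    · exact Or.inl ⟨⟨hQ, h0⟩, Set.disjoint_left.1 (hM.disjoint e) hn⟩
  · rintro (hQ | hQ)
    · exact ⟨hQ.1.1, (hQ.1.1.2.1 e).resolve_right hQ.2⟩
    · refine ⟨mem_compat_of_mem_H0 hΨ hQ, (hQ.2.1 e).resolve_right fun h => ?_⟩
      have h : e ∈ M.signals Q := h
      rw [signals_eq_empty_of_mem_H0 hQ] at h
      exact h

theorem Standing.localInfo_eq (hM : M.Standing) (hΨ : ∅ ∈ M.Ψ) (P : Measure (Paths E))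
    (e : Pair K) : M.localInfo P e = infoSet P (M.HΨ e ∪ M.H0) e.1 := by
  rw [localInfo, hM.setOf_marginal_mem_null hΨ]

/-- The local number has more competitors and uses less data. -/
theorem Standing.localInfo_le_globalInfo (hM : M.Standing) (hΨ : ∅ ∈ M.Ψ) (hP : P ∈ M.GΨ e) :
    M.localInfo P e ≤ M.globalInfo P e := by
  rw [hM.localInfo_eq hΨ]
  exact le_iInf₂ fun Q hQ => (iInf₂_le Q (Or.inl hQ)).trans
    (ENNReal.ofReal_le_ofReal (hM.info_mono hP (Or.inl hQ) subset_rfl (Finset.subset_univ _)))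

/-! ### The asymptotic relative efficiency -/

theorem nonempty_signals (hP : P ∈ M.compat M.Ψ \ M.H0) : (M.signals P).Nonempty :=
  Set.nonempty_iff_ne_empty.2 fun h0 => hP.2 ((mem_H0_iff hP.1).2 h0)

/-- The minimum of the local information numbers is attained. -/
theorem Standing.exists_iInf_localInfo_eq (hM : M.Standing) (hΨ : ∅ ∈ M.Ψ)
    (hP : P ∈ M.compat M.Ψ \ M.H0) (hH0 : Pair K → M.H0.Nonempty) :
    ∃ a : ℝ, 0 < a ∧ ⨅ e ∈ M.signals P, M.localInfo P e = ENNReal.ofReal a ∧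
      ∀ e ∈ M.signals P, ∀ Q ∈ M.HΨ e ∪ M.H0, a ≤ DepStructure.info P Q e.1 := by
  obtain ⟨e₀, he₀⟩ := nonempty_signals hP
  obtain ⟨e, he, Q, hQ, hinf, hmin⟩ := hM.exists_iInf_infoSet_eq (P := P) (A := M.signals P)
    (𝓠 := fun e => M.HΨ e ∪ M.H0)
    (fun e => Set.union_subset (fun Q h => h.1.1.1) fun Q h => h.1) (fun e => e.1)
    ⟨e₀, he₀, (hH0 e₀).mono Set.subset_union_right⟩
  refine ⟨_, (hM.isInfoNumber ⟨hP.1, he⟩ hQ subset_rfl).pos, ?_, hmin⟩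
  simp only [hM.localInfo_eq hΨ]
  exact hinf

theorem Design.H0_nonempty (d : M.Design) (e : Pair K) : M.H0.Nonempty := ⟨_, d.refDet_mem e⟩

theorem Design.Selected.ARE_le {d : M.Design} {h : Levels → Thresholds K} (hM : M.Standing)
    (hh : d.Selected h) (hP : P ∈ M.compat M.Ψ \ M.H0) (he : e ∈ M.signals P) (hQ : Q ∈ M.HΨ e)
    {a : ℝ} (ha0 : 0 < a) (ha : ∀ e ∈ M.signals P, ∀ Q ∈ M.HΨ e, a ≤ info P Q (d.iso e)) :
    d.ARE h P ≤ ENNReal.ofReal (info P Q Finset.univ / a) := by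
  have hPe : P ∈ M.GΨ e := ⟨hP.1, he⟩
  have hj := (hM.isInfoNumber hPe (Or.inl hQ) (Finset.subset_univ _)).pos
  set j := info P Q Finset.univ
  refine le_of_forall_gt_imp_ge_of_dense fun b hb => ?_
  obtain ⟨t, ht0, htj, htb⟩ := ENNReal.lt_iff_exists_real_btwn.1 hb
  refine le_trans ?_ htb.le
  have htj := (ENNReal.ofReal_lt_ofReal_iff_of_nonneg (by positivity)).1 htj
  obtain ⟨k, hjk, hkt⟩ := exists_between htj
  have hk : 0 < k := (by positivity : 0 < j / a).trans hjk
  have ht : 0 < t := hk.trans hkt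
  rw [div_lt_iff₀ ha0] at hjk
  -- With `j / a < k < t`, the rates `t / (k * a)` above and `1 / (k * a)` below are both
  -- admissible, and their quotient is `t`.
  have up := hh.eventually_ess_le hM hP ha (c := t / (k * a)) (by positivity) (by
    rw [div_mul_eq_mul_div, one_lt_div (by positivity)]
    exact mul_lt_mul_of_pos_right hkt ha0)
  have lo := (eventually_le_optimalESS hM hPe hQ (c := 1 / (k * a)) (by positivity) (by
    rw [div_mul_eq_mul_div, one_mul, div_lt_one (by positivity)]
    exact hjk)).filter_mono gammaRegime_le
  have hL := (tendsto_abs_log_γ.mono_left gammaRegime_le).eventually_gt_atTop 0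
  refine limsup_le_of_le (by isBoundedDefault) ?_
  filter_upwards [up, lo, hL] with l h1 h2 h3
  refine (ENNReal.div_le_div h1 h2).trans (le_of_eq ?_)
  rw [← ENNReal.ofReal_div_of_pos (by positivity)]
  congr 1
  field_simp

/-- Membership of `χ*` in the class makes its expected size at least the optimum. Dividing in `ℝ≥0∞`
also needs the optimum to be nonzero, from `T ≥ 1`, and finite, from the upper bound at any rate. -/
theorem Design.Selected.one_le_ARE {d : M.Design} {h : Levels → Thresholds K} (hM : M.Standing)
    (hh : d.Selected h) (hP : P ∈ M.compat M.Ψ \ M.H0) : 1 ≤ d.ARE h P := by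
  have := hM.prob P hP.1.1
  have := neBot_gammaRegime
  obtain ⟨a, ha0, ha⟩ : ∃ a : ℝ, 0 < a ∧
      ∀ e ∈ M.signals P, ∀ Q ∈ M.HΨ e, a ≤ info P Q (d.iso e) := by
    by_cases hne : ∃ e ∈ M.signals P, (M.HΨ e).Nonempty
    · obtain ⟨e, he, Q, hQ, -, hmin⟩ := hM.exists_iInf_infoSet_eq (P := P) (𝓠 := M.HΨ)
        (fun e Q h => h.1.1.1) d.iso hne
      exact ⟨_, (hM.isInfoNumber ⟨hP.1, he⟩ (Or.inl hQ) (d.sub_iso e)).pos, hmin⟩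
    · exact ⟨1, one_pos, fun e he Q hQ => absurd ⟨e, he, Q, hQ⟩ hne⟩
  have up := hh.eventually_ess_le hM hP ha (c := 2 / a) (by positivity) (by
    rw [div_mul_cancel₀ _ ha0.ne']
    exact one_lt_two)
  refine le_limsup_of_frequently_le (Eventually.frequently ?_) (by isBoundedDefault)
  filter_upwards [up, eventually_valid.filter_mono gammaRegime_le] with l h1 h2
  have hle : M.optimalESS P l ≤ (d.chiStar (h l)).ess P := iInf₂_le _ (hh.controls l h2)
  have h0 : (1 : ℝ≥0∞) ≤ M.optimalESS P l := by
    refine le_iInf₂ fun χ hχ => ?_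
    rw [← measure_univ (μ := P), ← lintegral_one]
    refine lintegral_mono fun x => ?_
    simpa using ENat.toENNReal_le.2 (hχ.test.one_le x)
  have htop : M.optimalESS P l ≠ ∞ :=
    ne_top_of_le_ne_top (ne_top_of_le_ne_top ENNReal.ofReal_ne_top h1) hle
  rw [ENNReal.le_div_iff_mul_le (Or.inl (one_pos.trans_le h0).ne') (Or.inl htop), one_mul]
  exact hle

theorem Design.Selected.ARE_le_efficiencyBound {d : M.Design} {h : Levels → Thresholds K}
    (hM : M.Standing) (hΨ : ∅ ∈ M.Ψ) (hh : d.Selected h) (hP : P ∈ M.compat M.Ψ \ M.H0)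
    (hiso : ∀ e, d.iso e = e.1) : d.ARE h P ≤ M.efficiencyBound P := by
  obtain ⟨a, ha0, hinf, ha⟩ := hM.exists_iInf_localInfo_eq hΨ hP d.H0_nonempty
  rw [efficiencyBound, hinf]
  by_cases hne : ∃ e ∈ M.signals P, (M.HΨ e).Nonempty
  · obtain ⟨e, he, Q, hQ, hJ, -⟩ := hM.exists_iInf_infoSet_eq (P := P) (𝓠 := M.HΨ)
      (fun e Q h => h.1.1.1) (fun _ => Finset.univ) hne
    have hJ : ⨅ e ∈ M.signals P, M.globalInfo P e = _ := hJ
    rw [hJ, ← ENNReal.ofReal_div_of_pos ha0]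
    exact hh.ARE_le hM hP he hQ ha0 fun e he Q hQ => hiso e ▸ ha e he Q (Or.inl hQ)
  -- Without any competitor the numerator is an empty infimum, so the bound is infinite.
  · have hJ : ⨅ e ∈ M.signals P, M.globalInfo P e = ∞ := by
      simp only [iInf_eq_top]
      intro e he
      have h0 : M.HΨ e = ∅ := Set.not_nonempty_iff_eq_empty.1 fun hn => hne ⟨e, he, hn⟩
      simp [globalInfo, infoSet, h0]
    rw [hJ, ENNReal.top_div_of_ne_top ENNReal.ofReal_ne_top]
    exact le_top

theorem Standing.efficiencyBound_eq_one (hM : M.Standing) (hΨ : ∅ ∈ M.Ψ)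
    (hP : P ∈ M.compat M.Ψ \ M.H0) (hH0 : Pair K → M.H0.Nonempty)
    (hle : ⨅ e ∈ M.signals P, M.globalInfo P e ≤ ⨅ e ∈ M.signals P, M.localInfo P e) :
    M.efficiencyBound P = 1 := by
  obtain ⟨a, ha0, hinf, -⟩ := hM.exists_iInf_localInfo_eq hΨ hP hH0
  have heq := hle.antisymm
    (iInf₂_mono fun e he => hM.localInfo_le_globalInfo hΨ (P := P) ⟨hP.1, he⟩)
  rw [efficiencyBound, heq, hinf]
  exact ENNReal.div_self (ENNReal.ofReal_pos.2 ha0).ne' ENNReal.ofReal_ne_top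

/-- If a signal is independent of all other sources and is not the only one, then its global
information number is at most the local one. -/
theorem Rich.globalInfo_le_localInfo (hR : M.Rich) (hM : M.Standing) (hΨ : ∅ ∈ M.Ψ)
    (hP : P ∈ M.GΨ e) (hs : IndepSources P e.1 e.1ᶜ) (hsig : ∃ f ∈ M.signals P, f ≠ e)
    (hmem : {f | f ∈ M.signals P ∧ f.1 ⊆ e.1ᶜ} ∈ M.Ψ) :
    M.globalInfo P e ≤ M.localInfo P e := by
  have heq : ∀ f : Pair K, f.1 ⊆ e.1 → f = e := fun f hf =>
    Subtype.ext (Finset.eq_of_subset_of_card_le hf (by rw [e.2, f.2]))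
  rw [hM.localInfo_eq hΨ]
  refine le_iInf₂ fun Q hQ => ?_
  have heQ : e ∉ M.signals Q := hQ.elim (fun h => h.2) fun h h' => by
    rw [signals_eq_empty_of_mem_H0 h] at h'
    exact h'
  obtain ⟨f, hf, hfe⟩ := hsig
  obtain ⟨R, hRH, hRi⟩ := hR.exists_mem_HΨ hM hΨ hP hQ subset_rfl hs
    ⟨f, hf, (hM.subset_or_of_mem_signals hP.1 hs hf).resolve_left fun h => hfe (heq f h)⟩ (by
      -- Only `e` itself fits inside `e`, and it is not a signal of `Q`; splicing therefore just
      -- deletes signals of `P`.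
      convert hmem using 3 with f
      refine or_iff_right fun h => heQ ?_
      rw [← heq f h.2]
      exact h.1)
  rw [← hRi]
  exact iInf₂_le R hRH

/-- `χ*` is efficient if the isolation subsystem of each signal contains the block of the signal. -/
theorem Design.Selected.ARE_eq_one_of_partition {d : M.Design} {h : Levels → Thresholds K}
    (hM : M.Standing) (hΨ : ∅ ∈ M.Ψ) (hh : d.Selected h) (hP : P ∈ M.compat M.Ψ \ M.H0)
    (hR : M.Rich) (hC : Recombinable M.Ψ) {L : ℕ} {v : Fin (L + 1) → Finset (Fin K)}
    (hv : M.IsIndepPartition P v) (hL : 1 < L)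
    (hiso : ∀ e ∈ M.signals P, ∃ l, l ≠ 0 ∧ e.1 ⊆ v l ∧ v l ⊆ d.iso e) : d.ARE h P = 1 := by
  have key : ∀ e ∈ M.signals P, ∀ Q ∈ M.HΨ e ∪ M.H0,
      ∃ R ∈ M.HΨ e, info P R Finset.univ ≤ info P Q (d.iso e) := by
    intro e he Q hQ
    obtain ⟨l, -, hel, hli⟩ := hiso e he
    have hPe : P ∈ M.GΨ e := ⟨hP.1, he⟩
    have hQc : Q ∈ M.compat M.Ψ := hQ.elim (fun h => h.1.1) fun h => mem_compat_of_mem_H0 hΨ h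
    have hs := hv.indepSources_compl l
    obtain ⟨R, hRH, hRi⟩ := hR.exists_mem_HΨ hM hΨ hPe hQ hel hs
      (hv.exists_signal_subset_compl hL l)
      (hC _ hP.1.2.2 _ hQc.2.2 (v l) fun f hf => hM.subset_or_of_mem_signals hP.1 hs hf)
    exact ⟨R, hRH, hRi.le.trans (hM.info_mono hPe hQ hel hli)⟩
  obtain ⟨e₀, he₀⟩ := nonempty_signals hP
  obtain ⟨Q₀, hQ₀⟩ := d.H0_nonempty e₀
  -- Splicing a global null law shows that global competitors exist, so their minimum is attained.
  obtain ⟨R₀, hR₀, -⟩ := key e₀ he₀ Q₀ (Or.inr hQ₀)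
  obtain ⟨e, he, Q, hQ, -, hmin⟩ := hM.exists_iInf_infoSet_eq (P := P) (𝓠 := M.HΨ)
    (fun e Q h => h.1.1.1) (fun _ => Finset.univ) ⟨e₀, he₀, R₀, hR₀⟩
  have hpos := (hM.isInfoNumber (P := P) ⟨hP.1, he⟩ (Or.inl hQ) (Finset.subset_univ _)).pos
  refine le_antisymm ?_ (hh.one_le_ARE hM hP)
  -- The minimal global number serves both as the lower-bound rate and, through `key`, as the
  -- constant `a`; the quotient is 1.
  refine (hh.ARE_le hM hP he hQ hpos fun e' he' Q' hQ' => ?_).trans ?_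
  · obtain ⟨R, hRH, hRi⟩ := key e' he' Q' (Or.inl hQ')
    exact (hmin e' he' R hRH).trans hRi
  · rw [div_self hpos.ne', ENNReal.ofReal_one]

end Problem

/-! ### The concrete signal families and the final theorem -/

theorem setOf_subset_compl_mem {Ψ : Set (Set (Pair K))}
    (hΨ : Ψ = psiDis K ∨ Ψ = psiClus K ∨ Ψ = Set.univ) {A : Set (Pair K)} (hA : A ∈ Ψ)
    (s : Finset (Fin K)) : {f | f ∈ A ∧ f.1 ⊆ sᶜ} ∈ Ψ := by
  rcases hΨ with rfl | rfl | rfl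
  · exact fun f hf f' hf' hne => hA f hf.1 f' hf'.1 hne
  · refine fun f hf f' hf' g hg => ⟨hA f hf.1 f' hf'.1 g hg, ?_⟩
    rw [hg]
    intro k hk
    rcases Finset.mem_symmDiff.1 hk with h | h
    · exact hf.2 h.1
    · exact hf'.2 h.1
  · trivial

end DepStructure

theorem mainTheorem11 {K : ℕ} {E : Fin K → Type*} [∀ k, MeasurableSpace (E k)]
    (M : DepStructure.Problem K E) (hM : M.Standing) (hΨ : ∅ ∈ M.Ψ)
    (P : Measure (DepStructure.Paths E)) (hP : P ∈ M.compat M.Ψ \ M.H0)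
    (d : M.Design) (h : DepStructure.Levels → DepStructure.Thresholds K) (hh : d.Selected h) :
    (M.Rich → DepStructure.Recombinable M.Ψ →
      ∀ (L : ℕ) (v : Fin (L + 1) → Finset (Fin K)), M.IsIndepPartition P v → 1 < L →
        (∀ e ∈ M.signals P, ∃ l, l ≠ 0 ∧ e.1 ⊆ v l ∧ v l ⊆ d.iso e) →
        d.ARE h P = 1) ∧
    ((∀ e, d.iso e = e.1) →
      d.ARE h P ≤ M.efficiencyBound P ∧
      (M.Rich → M.IndepSubs → M.Ψ = DepStructure.psiDis K → 1 < (M.signals P).ncard →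
        M.efficiencyBound P = 1 ∧ d.ARE h P = 1) ∧
      (M.Rich →
        (M.Ψ = DepStructure.psiDis K ∨ M.Ψ = DepStructure.psiClus K ∨ M.Ψ = Set.univ) →
        ∀ (L : ℕ) (v : Fin (L + 1) → Finset (Fin K)), M.IsIndepPartition P v → 1 < L →
        (∃ e ∈ M.signals P, DepStructure.IndepSources P e.1 e.1ᶜ ∧
          ∀ e' ∈ M.signals P, M.localInfo P e ≤ M.localInfo P e') →
        M.efficiencyBound P = 1 ∧ d.ARE h P = 1)) := by
  refine ⟨fun hR hC L v hv hL hiso => hh.ARE_eq_one_of_partition hM hΨ hP hR hC hv hL hiso,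
    fun hiso => ?_⟩
  have hle := hh.ARE_le_efficiencyBound hM hΨ hP hiso
  have hone : ⨅ e ∈ M.signals P, M.globalInfo P e ≤ ⨅ e ∈ M.signals P, M.localInfo P e →
      M.efficiencyBound P = 1 ∧ d.ARE h P = 1 := fun hinf => by
    have h1 := hM.efficiencyBound_eq_one hΨ hP d.H0_nonempty hinf
    exact ⟨h1, le_antisymm (h1 ▸ hle) (hh.one_le_ARE hM hP)⟩
  refine ⟨hle, fun hR hI hdis hcard => hone (iInf₂_mono fun e he => ?_),
    fun hR hfam L v hv hL ⟨e, he, hind, hmin⟩ => hone ?_⟩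
  -- Disjoint signals leave none between `e` and its complement, so by `hI` every signal is an
  -- independent block and the comparison holds unit by unit.
  · have hdisj : ∀ f ∈ M.signals P, f ≠ e → Disjoint f.1 e.1 := fun f hf hfe => by
      have hmem := hP.1.2.2
      rw [hdis] at hmem
      exact hmem f hf e he hfe
    refine hR.globalInfo_le_localInfo hM hΨ ⟨hP.1, he⟩ ?_
      (Set.exists_ne_of_one_lt_ncard hcard e)
      (DepStructure.setOf_subset_compl_mem (Or.inl hdis) hP.1.2.2 e.1)
    refine (hI P hP.1 e.1 e.1ᶜ disjoint_compl_right).2 fun i hi j hj f hf hfP => ?_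
    have hif : i ∈ f.1 := hf ▸ Finset.mem_insert_self i {j}
    have hjf : j ∈ f.1 := hf ▸ Finset.mem_insert_of_mem (Finset.mem_singleton_self j)
    have hfe : f ≠ e := fun h => Finset.mem_compl.1 hj (h ▸ hjf)
    exact Finset.disjoint_left.1 (hdisj f hfP hfe) hif hi
  · refine (iInf₂_le e he).trans (le_trans ?_ (le_iInf₂ hmin))
    refine hR.globalInfo_le_localInfo hM hΨ ⟨hP.1, he⟩ hind ?_
      (DepStructure.setOf_subset_compl_mem hfam hP.1.2.2 e.1)
    -- One signal inside a block and another in its complement cannot both equal `e`, so `e` is not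
    -- the only signal.
    obtain ⟨l₁, -, e₁, he₁, hl₁⟩ := hv.exists_signal_ne hL 0
    obtain ⟨e₂, he₂, hl₂⟩ := hv.exists_signal_subset_compl hL l₁
    by_contra! hall
    obtain ⟨k, hk⟩ := Finset.card_pos.1 (by rw [e.2]; exact two_pos : 0 < e.1.card)
    rw [hall e₁ he₁] at hl₁
    rw [hall e₂ he₂] at hl₂
    exact Finset.mem_compl.1 (hl₂ hk) (hl₁ hk)
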